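/- Let $\mathcal C$ be a braided monoidal category with braiding $c$ and unit object $I$; write $XY$ for the monoidal product, $g.f$ for the composite of $f$ followed by $g$, $1$ for identity morphisms, and suppress associativity and unit isomorphisms. Let $\mathcal Q$ be a class of regular epimorphisms of $\mathcal C$ which contains the isomorphisms, is closed under composition and monoidal product, is right-cancellative (if $s$ and $t.s$ lie in $\mathcal Q$ then so does $t$), and such that each $q\in\mathcal Q$ is the coequalizer of some pair of morphisms whose coequalizer is preserved by taking the monoidal product with any object. *The monoidal category $\mathcal M$.* A semigroup $(A,m)$ in $\mathcal C$ (an object $A$ with an associative $m\colon A^2\to A$) is *non-degenerate* if for all objects $X,Y$ the maps $\mathcal C(X,YA)\to\mathcal C(XA,YA)$, $f\mapsto 1m.f1$, and $\mathcal C(X,AY)\to\mathcal C(AX,AY)$, $g\mapsto m1.1g$, are injective. An *$\mathbb M$-morphism* $f\colon A\nrightarrow B$ from an object $A$ to a non-degenerate semigroup $B$ is a pair $(f_1\colon AB\to B,\ f_2\colon BA\to B)$ with $m.1f_1=m.f_21$. If $A$ is a semigroup, it is *multiplicative* if $f_1.m1=f_1.1f_1$ and $f_2.1m=f_2.f_21$.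 It is *dense* if $f_1,f_2\in\mathcal Q$. The objects of $\mathcal M$ are the non-degenerate semigroups with multiplication in $\mathcal Q$; its morphisms are the dense multiplicative $\mathbb M$-morphisms; the composite $g\bullet f$ of $f\colon A\nrightarrow B$ and $g\colon B\nrightarrow C$ is the unique $\mathbb M$-morphism with $(g\bullet f)_1.1g_1=g_1.f_11$ and $(g\bullet f)_2.g_21=g_2.1f_2$; the identity of $A$ is $(m,m)$. The monoidal product of semigroups $A,B$ is $AB$ with multiplication $mm.1c1$, and the monoidal product of $f\colon A\nrightarrow B$ and $f'\colon A'\nrightarrow B'$ has components $f_1f_1'.1c1$ and $f_2f_2'.1c1$. The monoidal unit is $I$ with its trivial multiplication, and the associativity and unit isomorphisms are those induced from $\mathcal C$, where a multiplicative isomorphism $\varphi\colon A\to B$ in $\mathcal C$ induces the morphism of $\mathcal M$ with components $m.\varphi1$ and $m.1\varphi$. *Multiplier bimonoids.* A *multiplier bimonoid* $(A,t_1,t_2,e)$ in $\mathcal C$ consists of an object $A$ and morphisms $t_1,t_2\colon A^2\to A^2$, $e\colon A\to I$ such that $$t_11.1c.t_11.1c^{-1}.1t_1=1t_1.t_11,\quad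 1e.t_1=1e,\qquad 1t_2.c1.1t_2.c^{-1}1.t_21=t_21.1t_2,\quad e1.t_2=e1,$$ $$t_21.1t_1=1t_1.t_21,\qquad e1.t_1=1e.t_2.$$ **Theorem.** Let $(A,m)$ be an object of $\mathcal M$ and let $t_1,t_2\colon A^2\to A^2$ and $e\colon A\to I$ be morphisms of $\mathcal C$. Put $$d_1=m1.1c.t_11.1c^{-1}\colon A^3\to A^2,\qquad d_2=1m.c1.1t_2.c^{-1}1\colon A^3\to A^2 .$$ The following are equivalent. (i) There is a comonoid in $\mathcal M$ with underlying object $(A,m)$, whose counit is the $\mathbb M$-morphism $A\nrightarrow I$ with both components $e$, and whose comultiplication is the $\mathbb M$-morphism $A\nrightarrow A^2$ with components $(d_1,d_2)$. (ii) $(A,t_1,t_2,e)$ is a multiplier bimonoid in $\mathcal C$ such that $e1.t_1=1e.t_2$ is equal to $m$, and $e$, $d_1$ and $d_2$ lie in $\mathcal Q$. -/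

import Mathlib

open CategoryTheory MonoidalCategory Limits

universe v u

namespace MultBimon

section Assumptions

/-- The standing assumptions on a distinguished class `Q` of morphisms of a braided monoidal
category: it consists of regular epimorphisms, is closed under composition and monoidal product,
contains the isomorphisms, is right-cancellative, and each of its members is the coequalizer of
some pair whose coequalizer is preserved by taking the monoidal product with any object.
(By the braiding, preservation by `X ⊗ -` and by `- ⊗ X` are the same condition.) -/
class StandingAssumptions {C : Type u} [Category.{v} C] [MonoidalCategory C] [BraidedCategory C]
    (Q : MorphismProperty C) : Prop where
  comp_mem : ∀ {X Y Z : C} (f : X ⟶ Y) (g : Y ⟶ Z), Q f → Q g → Q (f ≫ g)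
  iso_mem : ∀ {X Y : C} (f : X ⟶ Y), IsIso f → Q f
  tensor_mem : ∀ {X Y X' Y' : C} (f : X ⟶ Y) (g : X' ⟶ Y'), Q f → Q g → Q (f ⊗ₘ g)
  right_cancel : ∀ {X Y Z : C} (s : X ⟶ Y) (t : Y ⟶ Z), Q s → Q (s ≫ t) → Q t
  exists_coequalizer : ∀ {Y Z : C} (q : Y ⟶ Z), Q q →
    ∃ (W : C) (a b : W ⟶ Y) (w : a ≫ q = b ≫ q), Nonempty (IsColimit (Cofork.ofπ q w)) ∧
      ∀ X : C, PreservesColimit (parallelPair a b) (tensorLeft X)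

variable {C : Type u} [Category.{v} C] [MonoidalCategory C] [BraidedCategory C]
  (Q : MorphismProperty C) [hQ : StandingAssumptions Q]

namespace StandingAssumptions

variable {Q}

lemma whiskerLeft_mem (X : C) {Y Z : C} {q : Y ⟶ Z} (h : Q q) : Q (X ◁ q) := by
  rw [← id_tensorHom]
  exact tensor_mem _ _ (iso_mem _ inferInstance) h

lemma whiskerRight_mem (X : C) {Y Z : C} {q : Y ⟶ Z} (h : Q q) : Q (q ▷ X) := by
  rw [← tensorHom_id]
  exact tensor_mem _ _ h (iso_mem _ inferInstance)

lemma epi_of_mem {Y Z : C} {q : Y ⟶ Z} (h : Q q) : Epi q := by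
  obtain ⟨W, a, b, w, ⟨l⟩, -⟩ := exists_coequalizer q h
  exact epi_of_isColimit_cofork l

lemma desc_left (X : C) {Y Z W : C} {q : Y ⟶ Z} (h : Q q) (k : X ⊗ Y ⟶ W)
    (hk : ∀ {T : C} (s t : T ⟶ Y), s ≫ q = t ≫ q → X ◁ s ≫ k = X ◁ t ≫ k) :
    ∃ d : X ⊗ Z ⟶ W, X ◁ q ≫ d = k := by
  obtain ⟨T, a, b, w, ⟨l⟩, hp⟩ := exists_coequalizer q h
  have := hp X
  have l' := isColimitCoforkMapOfIsColimit (tensorLeft X) w l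
  exact ⟨_, Cofork.IsColimit.π_desc' l' k (hk a b w)⟩

lemma desc_right (X : C) {Y Z W : C} {q : Y ⟶ Z} (h : Q q) (k : Y ⊗ X ⟶ W)
    (hk : ∀ {T : C} (s t : T ⟶ Y), s ≫ q = t ≫ q → s ▷ X ≫ k = t ▷ X ≫ k) :
    ∃ d : Z ⊗ X ⟶ W, q ▷ X ≫ d = k := by
  obtain ⟨d, hd⟩ := desc_left X h ((β_ X Y).hom ≫ k) (fun s t hst => by
    simp only [BraidedCategory.braiding_naturality_right_assoc, hk s t hst])
  refine ⟨(β_ X Z).inv ≫ d, ?_⟩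
  rw [BraidedCategory.braiding_inv_naturality_left_assoc, hd, Iso.inv_hom_id_assoc]

end StandingAssumptions

end Assumptions

section Semigroups

/-- A semigroup in a monoidal category. -/
structure Semigrp (C : Type u) [Category.{v} C] [MonoidalCategory C] where
  X : C
  mul : X ⊗ X ⟶ X
  mul_assoc : mul ▷ X ≫ mul = (α_ X X X).hom ≫ X ◁ mul ≫ mul

variable {C : Type u} [Category.{v} C] [MonoidalCategory C]

/-- Non-degeneracy of the multiplication of a semigroup. -/
structure Semigrp.Nondegenerate (A : Semigrp C) : Prop where
  right : ∀ X Y : C, Function.Injective (fun f : X ⟶ Y ⊗ A.X =>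
    (f ▷ A.X ≫ (α_ Y A.X A.X).hom ≫ Y ◁ A.mul : X ⊗ A.X ⟶ Y ⊗ A.X))
  left : ∀ X Y : C, Function.Injective (fun g : X ⟶ A.X ⊗ Y =>
    (A.X ◁ g ≫ (α_ A.X A.X Y).inv ≫ A.mul ▷ Y : A.X ⊗ X ⟶ A.X ⊗ Y))

lemma Semigrp.Nondegenerate.cancel_right {A : Semigrp C} (hA : A.Nondegenerate) {X : C}
    {f g : X ⟶ A.X} (h : f ▷ A.X ≫ A.mul = g ▷ A.X ≫ A.mul) : f = g := by
  have key : f ≫ (λ_ A.X).inv = g ≫ (λ_ A.X).inv := by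
    apply hA.right X (𝟙_ C)
    have aux : ∀ f : X ⟶ A.X, (f ≫ (λ_ A.X).inv) ▷ A.X ≫ (α_ (𝟙_ C) A.X A.X).hom ≫
        (𝟙_ C) ◁ A.mul = (f ▷ A.X ≫ A.mul) ≫ (λ_ A.X).inv := fun f => by simp
    simp only [aux, h]
  simpa using key =≫ (λ_ A.X).hom

lemma Semigrp.Nondegenerate.cancel_left {A : Semigrp C} (hA : A.Nondegenerate) {X : C}
    {f g : X ⟶ A.X} (h : A.X ◁ f ≫ A.mul = A.X ◁ g ≫ A.mul) : f = g := by
  have key : f ≫ (ρ_ A.X).inv = g ≫ (ρ_ A.X).inv := by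
    apply hA.left X (𝟙_ C)
    have aux : ∀ f : X ⟶ A.X, A.X ◁ (f ≫ (ρ_ A.X).inv) ≫ (α_ A.X A.X (𝟙_ C)).inv ≫
        A.mul ▷ (𝟙_ C) = (A.X ◁ f ≫ A.mul) ≫ (ρ_ A.X).inv := fun f => by simp
    simp only [aux, h]
  simpa using key =≫ (ρ_ A.X).hom

/-- An `𝕄`-morphism from an object `A` to a semigroup `B` (which is non-degenerate in all uses):
a pair of morphisms `f₁ : AB ⟶ B` and `f₂ : BA ⟶ B` that are compatible. -/
structure MMor (A : C) (B : Semigrp C) where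
  fst : A ⊗ B.X ⟶ B.X
  snd : B.X ⊗ A ⟶ B.X
  compat : snd ▷ B.X ≫ B.mul = (α_ B.X A B.X).hom ≫ B.X ◁ fst ≫ B.mul

/-- Multiplicativity of an `𝕄`-morphism between semigroups. -/
structure MMor.IsMultiplicative {A B : Semigrp C} (f : MMor A.X B) : Prop where
  fst : A.mul ▷ B.X ≫ f.fst = (α_ A.X A.X B.X).hom ≫ A.X ◁ f.fst ≫ f.fst
  snd : f.snd ▷ A.X ≫ f.snd = (α_ B.X A.X A.X).hom ≫ B.X ◁ A.mul ≫ f.snd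

/-- Density of an `𝕄`-morphism: both components belong to the class `Q`. -/
structure MMor.IsDense (Q : MorphismProperty C) {A : C} {B : Semigrp C} (f : MMor A B) : Prop where
  fst : Q f.fst
  snd : Q f.snd

lemma MMor.ext_fst {A : C} {B : Semigrp C} (hB : B.Nondegenerate) {f g : MMor A B}
    (h : f.fst = g.fst) : f = g := by
  have h2 : f.snd = g.snd := hB.cancel_right (by rw [f.compat, g.compat, h])
  cases f; cases g; cases h; cases h2; rfl

/-- First components are right linear. -/
lemma MMor.fst_linear {A : C} {B : Semigrp C} (hB : B.Nondegenerate) (f : MMor A B) :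
    f.fst ▷ B.X ≫ B.mul = (α_ A B.X B.X).hom ≫ A ◁ B.mul ≫ f.fst := by
  apply hB.cancel_left
  have h1 : B.X ◁ (f.fst ▷ B.X ≫ B.mul) ≫ B.mul =
      (α_ B.X (A ⊗ B.X) B.X).inv ≫ (α_ B.X A B.X).inv ▷ B.X ≫ 
        (f.snd ▷ B.X ≫ B.mul) ▷ B.X ≫ B.mul := by
    rw [f.compat]
    simp only [comp_whiskerRight, Category.assoc, B.mul_assoc, MonoidalCategory.whiskerLeft_comp]
    simp
  have h2 : B.X ◁ ((α_ A B.X B.X).hom ≫ A ◁ B.mul ≫ f.fst) ≫ B.mul =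
      B.X ◁ (α_ A B.X B.X).hom ≫ B.X ◁ A ◁ B.mul ≫ (α_ B.X A B.X).inv ≫
        f.snd ▷ B.X ≫ B.mul := by
    rw [f.compat]
    simp
  rw [h1, h2, comp_whiskerRight, Category.assoc, B.mul_assoc]
  rw [associator_inv_naturality_right_assoc, whisker_exchange_assoc]
  simp

lemma MMor.snd_linear {A : C} {B : Semigrp C} (hB : B.Nondegenerate) (f : MMor A B) :
    B.mul ▷ A ≫ f.snd = (α_ B.X B.X A).hom ≫ B.X ◁ f.snd ≫ B.mul := by
  apply hB.cancel_right
  rw [comp_whiskerRight, Category.assoc, f.compat]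
  simp only [comp_whiskerRight, Category.assoc, B.mul_assoc]
  rw [associator_naturality_left_assoc, ← whisker_exchange_assoc, B.mul_assoc]
  have h := congrArg (fun t => B.X ◁ t ≫ B.mul) f.compat
  simp only [MonoidalCategory.whiskerLeft_comp, Category.assoc] at h
  rw [associator_naturality_middle_assoc, h]
  simp

end Semigroups

section Composition

variable {C : Type u} [Category.{v} C] [MonoidalCategory C]

/-- `h` is the composite `g • f`: the two diagrams that determine its components commute. -/
structure IsComposite {A : C} {B D : Semigrp C} (f : MMor A B) (g : MMor B.X D)
    (h : MMor A D) : Prop where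
  fst : f.fst ▷ D.X ≫ g.fst = (α_ A B.X D.X).hom ≫ A ◁ g.fst ≫ h.fst
  snd : g.snd ▷ A ≫ h.snd = (α_ D.X B.X A).hom ≫ D.X ◁ f.snd ≫ g.snd

lemma comp_aux_fst {A : C} {B D : Semigrp C} (f : MMor A B) (g : MMor B.X D)
    (hg : g.IsMultiplicative) {X : C} (s : X ⟶ B.X ⊗ D.X) :
    B.X ◁ (A ◁ s ≫ (α_ A B.X D.X).inv ≫ f.fst ▷ D.X ≫ g.fst) ≫ g.fst =
      (α_ B.X A X).inv ≫ f.snd ▷ X ≫ B.X ◁ (s ≫ g.fst) ≫ g.fst := by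
  have h1 : B.X ◁ g.fst ≫ g.fst = (α_ B.X B.X D.X).inv ≫ B.mul ▷ D.X ≫ g.fst := by
    rw [hg.fst, Iso.inv_hom_id_assoc]
  have h2 := congrArg (fun t => t ▷ D.X ≫ g.fst) f.compat
  simp only [comp_whiskerRight, Category.assoc] at h2
  simp only [MonoidalCategory.whiskerLeft_comp, Category.assoc, h1]
  rw [associator_inv_naturality_middle_assoc]
  have h3 : (B.X ◁ f.fst) ▷ D.X ≫ B.mul ▷ D.X ≫ g.fst =
      (α_ B.X A B.X).inv ▷ D.X ≫ f.snd ▷ B.X ▷ D.X ≫ B.mul ▷ D.X ≫ g.fst := by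
    rw [h2, ← comp_whiskerRight_assoc]; simp
  rw [h3, ← whisker_exchange_assoc]
  simp

lemma comp_aux_snd {A : C} {B D : Semigrp C} (f : MMor A B) (g : MMor B.X D)
    (hg : g.IsMultiplicative) {X : C} (s : X ⟶ D.X ⊗ B.X) :
    (s ▷ A ≫ (α_ D.X B.X A).hom ≫ D.X ◁ f.snd ≫ g.snd) ▷ B.X ≫ g.snd =
      (α_ X A B.X).hom ≫ X ◁ f.fst ≫ (s ≫ g.snd) ▷ B.X ≫ g.snd := by
  have h2 := congrArg (fun t => D.X ◁ t ≫ g.snd) f.compat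
  simp only [MonoidalCategory.whiskerLeft_comp, Category.assoc] at h2
  simp only [comp_whiskerRight, Category.assoc, hg.snd]
  rw [associator_naturality_middle_assoc, h2, whisker_exchange_assoc]
  simp

variable [BraidedCategory C] {Q : MorphismProperty C} [hQ : StandingAssumptions Q]

open StandingAssumptions

lemma comp_key_fst {A : C} {B D : Semigrp C} (hD : D.Nondegenerate) (f : MMor A B)
    (g : MMor B.X D) (hg : g.IsMultiplicative) (hg' : g.IsDense Q) {X : C}
    (s t : X ⟶ B.X ⊗ D.X) (h : s ≫ g.fst = t ≫ g.fst) :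
    A ◁ s ≫ (α_ A B.X D.X).inv ≫ f.fst ▷ D.X ≫ g.fst =
      A ◁ t ≫ (α_ A B.X D.X).inv ≫ f.fst ▷ D.X ≫ g.fst := by
  have := epi_of_mem (whiskerRight_mem (A ⊗ X) hg'.snd)
  apply hD.cancel_left
  rw [← cancel_epi (g.snd ▷ (A ⊗ X)), ← whisker_exchange_assoc, ← whisker_exchange_assoc, g.compat]
  have h1 := comp_aux_fst f g hg s
  have h2 := comp_aux_fst f g hg t
  rw [h, ← h2] at h1
  have h3 := congrArg (fun t => (α_ D.X B.X (A ⊗ X)).hom ≫ D.X ◁ t ≫ D.mul) h1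
  simp only [MonoidalCategory.whiskerLeft_comp _ (B.X ◁ _), Category.assoc] at h3
  rw [← associator_naturality_right_assoc, ← associator_naturality_right_assoc] at h3
  exact h3

lemma comp_key_snd {A : C} {B D : Semigrp C} (hD : D.Nondegenerate) (f : MMor A B)
    (g : MMor B.X D) (hg : g.IsMultiplicative) (hg' : g.IsDense Q) {X : C}
    (s t : X ⟶ D.X ⊗ B.X) (h : s ≫ g.snd = t ≫ g.snd) :
    s ▷ A ≫ (α_ D.X B.X A).hom ≫ D.X ◁ f.snd ≫ g.snd =
      t ▷ A ≫ (α_ D.X B.X A).hom ≫ D.X ◁ f.snd ≫ g.snd := by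
  have := epi_of_mem (whiskerLeft_mem (X ⊗ A) hg'.fst)
  apply hD.cancel_right
  rw [← cancel_epi ((X ⊗ A) ◁ g.fst), whisker_exchange_assoc, whisker_exchange_assoc]
  have hc : D.X ◁ g.fst ≫ D.mul = (α_ D.X B.X D.X).inv ≫ g.snd ▷ D.X ≫ D.mul := by
    rw [g.compat, Iso.inv_hom_id_assoc]
  rw [hc]
  have h1 := comp_aux_snd f g hg s
  have h2 := comp_aux_snd f g hg t
  rw [h, ← h2] at h1
  have h3 := congrArg (fun t => (α_ (X ⊗ A) B.X D.X).inv ≫ t ▷ D.X ≫ D.mul) h1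
  simp only [comp_whiskerRight _ g.snd, Category.assoc] at h3
  rw [← associator_inv_naturality_left_assoc, ← associator_inv_naturality_left_assoc] at h3
  exact h3

/-- Existence of the composite of an `𝕄`-morphism with a dense multiplicative one. -/
lemma exists_composite {A : C} {B D : Semigrp C} (hD : D.Nondegenerate) (f : MMor A B)
    (g : MMor B.X D) (hg : g.IsMultiplicative) (hg' : g.IsDense Q) :
    ∃ h : MMor A D, IsComposite f g h := by
  obtain ⟨d₁, hd₁⟩ := desc_left A hg'.fst ((α_ A B.X D.X).inv ≫ f.fst ▷ D.X ≫ g.fst)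
    (comp_key_fst hD f g hg hg')
  obtain ⟨d₂, hd₂⟩ := desc_right A hg'.snd ((α_ D.X B.X A).hom ≫ D.X ◁ f.snd ≫ g.snd)
    (comp_key_snd hD f g hg hg')
  have key : f.snd ▷ D.X ≫ g.fst = (α_ B.X A D.X).hom ≫ B.X ◁ d₁ ≫ g.fst := by
    have := epi_of_mem (whiskerLeft_mem (B.X ⊗ A) hg'.fst)
    rw [← cancel_epi ((B.X ⊗ A) ◁ g.fst)]
    have h1 := comp_aux_fst f g hg (𝟙 _)
    rw [MonoidalCategory.whiskerLeft_id, Category.id_comp, Category.id_comp, ← hd₁,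
      Iso.eq_inv_comp] at h1
    rw [whisker_exchange_assoc, ← h1]
    simp
  refine ⟨⟨d₁, d₂, ?_⟩, ⟨?_, hd₂⟩⟩
  · have := epi_of_mem (whiskerRight_mem D.X (whiskerRight_mem A hg'.snd))
    rw [← cancel_epi (g.snd ▷ A ▷ D.X), ← comp_whiskerRight_assoc, hd₂]
    have h1 : (D.X ◁ f.snd ≫ g.snd) ▷ D.X ≫ D.mul =
      (α_ _ _ _).hom ≫ D.X ◁ (f.snd ▷ D.X ≫ g.fst) ≫ D.mul := by
      rw [comp_whiskerRight, Category.assoc, g.compat]; simp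
    rw [comp_whiskerRight, Category.assoc, h1, key, associator_naturality_left_assoc,
      ← whisker_exchange_assoc, g.compat]
    simp
  · dsimp only
    rw [hd₁, Iso.hom_inv_id_assoc]

lemma IsComposite.fst_eq {A : C} {B D : Semigrp C} {f : MMor A B} {g : MMor B.X D}
    {h : MMor A D} (H : IsComposite f g h) (hg' : g.IsDense Q) {k : A ⊗ D.X ⟶ D.X}
    (hk : f.fst ▷ D.X ≫ g.fst = (α_ A B.X D.X).hom ≫ A ◁ g.fst ≫ k) : h.fst = k := by
  have := epi_of_mem (whiskerLeft_mem A hg'.fst)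
  rw [← cancel_epi (A ◁ g.fst), ← cancel_epi (α_ A B.X D.X).hom, ← hk, H.fst]

lemma IsComposite.isDense {A : C} {B D : Semigrp C} {f : MMor A B} {g : MMor B.X D}
    {h : MMor A D} (H : IsComposite f g h) (hf' : f.IsDense Q) (hg' : g.IsDense Q) :
    h.IsDense Q where
  fst := right_cancel ((α_ A B.X D.X).hom ≫ A ◁ g.fst) _
    (comp_mem _ _ (iso_mem _ inferInstance) (whiskerLeft_mem _ hg'.fst))
    (by rw [Category.assoc, ← H.fst]; exact comp_mem _ _ (whiskerRight_mem _ hf'.fst) hg'.fst)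
  snd := right_cancel (g.snd ▷ A) _ (whiskerRight_mem _ hg'.snd)
    (by rw [H.snd]
        exact comp_mem _ _ (iso_mem _ inferInstance)
          (comp_mem _ _ (whiskerLeft_mem _ hf'.snd) hg'.snd))

lemma IsComposite.isMultiplicative {A B D : Semigrp C} {f : MMor A.X B} {g : MMor B.X D}
    {h : MMor A.X D} (H : IsComposite f g h) (hf : f.IsMultiplicative) (hg' : g.IsDense Q) :
    h.IsMultiplicative where
  fst := by
    have := epi_of_mem (whiskerLeft_mem (A.X ⊗ A.X) hg'.fst)
    rw [← cancel_epi ((A.X ⊗ A.X) ◁ g.fst), ← cancel_epi (α_ (A.X ⊗ A.X) B.X D.X).hom,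
      whisker_exchange_assoc, ← associator_naturality_left_assoc, ← H.fst,
      ← comp_whiskerRight_assoc, hf.fst]
    have h1 := congrArg (fun t => A.X ◁ t) H.fst
    simp only [MonoidalCategory.whiskerLeft_comp] at h1
    simp only [comp_whiskerRight, Category.assoc, H.fst, tensor_whiskerLeft, Iso.inv_hom_id_assoc,
      associator_naturality_middle_assoc]
    rw [reassoc_of% h1]
    simp
  snd := by
    have := epi_of_mem (whiskerRight_mem A.X (whiskerRight_mem A.X hg'.snd))
    rw [← cancel_epi (g.snd ▷ A.X ▷ A.X), ← comp_whiskerRight_assoc, H.snd,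
      associator_naturality_left_assoc, ← whisker_exchange_assoc, H.snd]
    have h1 := congrArg (fun t => D.X ◁ t ≫ g.snd) hf.snd
    simp only [MonoidalCategory.whiskerLeft_comp, Category.assoc] at h1
    simp only [comp_whiskerRight, Category.assoc, H.snd, associator_naturality_middle_assoc, h1]
    simp

end Composition

section CategoryM

variable {C : Type u} [Category.{v} C] [MonoidalCategory C]

lemma whisker_iso_aux {X X' Y Y' Z : C} (φ : X ≅ X') (ψ : Y ≅ Y') (k : X' ⊗ Y' ⟶ Z) :
    X ◁ ψ.inv ≫ (φ.hom ⊗ₘ ψ.hom) ≫ k = φ.hom ▷ Y' ≫ k := by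
  rw [MonoidalCategory.tensorHom_def']
  simp

/-- The objects of the category `ℳ`: non-degenerate semigroups with multiplication in `Q`. -/
structure MCat (Q : MorphismProperty C) where
  toSemigrp : Semigrp C
  nondeg : toSemigrp.Nondegenerate
  mul_mem : Q toSemigrp.mul

/-- The underlying object in the base category. -/
abbrev MCat.X {Q : MorphismProperty C} (A : MCat Q) : C := A.toSemigrp.X

/-- The multiplication. -/
abbrev MCat.mul {Q : MorphismProperty C} (A : MCat Q) : A.X ⊗ A.X ⟶ A.X := A.toSemigrp.mul

/-- The morphisms of the category `ℳ`: the dense multiplicative `𝕄`-morphisms. -/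
structure MHom {Q : MorphismProperty C} (A B : MCat Q) where
  mor : MMor A.X B.toSemigrp
  mult : mor.IsMultiplicative
  dense : mor.IsDense Q

/-- A multiplicative isomorphism of semigroups. -/
structure MIso {Q : MorphismProperty C} (A B : MCat Q) where
  iso : A.X ≅ B.X
  map_mul : A.mul ≫ iso.hom = (iso.hom ⊗ₘ iso.hom) ≫ B.mul

namespace MHom

variable {Q : MorphismProperty C}

lemma ext_fst {A B : MCat Q} {f g : MHom A B} (h : f.mor.fst = g.mor.fst) : f = g := by
  have := MMor.ext_fst B.nondeg h
  cases f; cases g; cases this; rfl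

/-- The identity, with both components equal to the multiplication. -/
def id (A : MCat Q) : MHom A A where
  mor := ⟨A.mul, A.mul, A.toSemigrp.mul_assoc⟩
  mult := ⟨A.toSemigrp.mul_assoc, A.toSemigrp.mul_assoc⟩
  dense := ⟨A.mul_mem, A.mul_mem⟩

variable [BraidedCategory C] [hQ : StandingAssumptions Q]

open StandingAssumptions

lemma exists_comp {A B D : MCat Q} (f : MHom A B) (g : MHom B D) :
    ∃ h : MHom A D, IsComposite f.mor g.mor h.mor := by
  obtain ⟨h, H⟩ := exists_composite D.nondeg f.mor g.mor g.mult g.dense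
  exact ⟨⟨h, H.isMultiplicative f.mult g.dense, H.isDense f.dense g.dense⟩, H⟩

/-- The composite `g • f`, uniquely determined by `MHom.isComposite_comp`. -/
noncomputable def comp {A B D : MCat Q} (f : MHom A B) (g : MHom B D) : MHom A D :=
  (exists_comp f g).choose

lemma isComposite_comp {A B D : MCat Q} (f : MHom A B) (g : MHom B D) :
    IsComposite f.mor g.mor (f.comp g).mor :=
  (exists_comp f g).choose_spec

lemma comp_fst_eq {A B D : MCat Q} (f : MHom A B) (g : MHom B D) {k : A.X ⊗ D.X ⟶ D.X}
    (hk : f.mor.fst ▷ D.X ≫ g.mor.fst = (α_ A.X B.X D.X).hom ≫ A.X ◁ g.mor.fst ≫ k) :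
    (f.comp g).mor.fst = k :=
  (isComposite_comp f g).fst_eq g.dense hk

end MHom

variable {Q : MorphismProperty C} [BraidedCategory C] [hQ : StandingAssumptions Q]

open StandingAssumptions

/-- The category `ℳ`. -/
noncomputable instance MCat.category : Category.{v} (MCat Q) where
  Hom A B := MHom A B
  id A := MHom.id A
  comp f g := MHom.comp f g
  id_comp f := MHom.ext_fst (MHom.comp_fst_eq _ _ f.mult.fst)
  comp_id {A B} f := MHom.ext_fst (MHom.comp_fst_eq _ _ (f.mor.fst_linear B.nondeg))
  assoc {A B D E} f g h := MHom.ext_fst (by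
    apply MHom.comp_fst_eq
    have e1 := epi_of_mem (whiskerRight_mem E.X (whiskerLeft_mem A.X g.dense.fst))
    have Hgh := (MHom.isComposite_comp g h).fst
    have Hfg := (MHom.isComposite_comp f g).fst
    have Hfgh := (MHom.isComposite_comp f (g.comp h)).fst
    rw [← Iso.inv_comp_eq] at Hfg Hfgh
    have h1 := congrArg (fun t => A.X ◁ t) Hgh
    simp only [MonoidalCategory.whiskerLeft_comp] at h1
    rw [← cancel_epi ((A.X ◁ g.mor.fst) ▷ E.X), ← comp_whiskerRight_assoc, ← Hfg]
    simp only [comp_whiskerRight, Category.assoc, Hgh, associator_naturality_middle_assoc]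
    rw [reassoc_of% h1, ← Hfgh, associator_naturality_left_assoc, ← whisker_exchange_assoc]
    simp)

end CategoryM

section Monoidality

variable {C : Type u} [Category.{v} C] [MonoidalCategory C] [BraidedCategory C]

/-- Two commutative squares of associativity type can be tensored. -/
lemma tensor_square {X Y Z P R W X' Y' Z' P' R' W' : C}
    {p : X ⊗ Y ⟶ P} {q : P ⊗ Z ⟶ W} {r : Y ⊗ Z ⟶ R} {s : X ⊗ R ⟶ W}
    {p' : X' ⊗ Y' ⟶ P'} {q' : P' ⊗ Z' ⟶ W'} {r' : Y' ⊗ Z' ⟶ R'} {s' : X' ⊗ R' ⟶ W'}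
    (h : p ▷ Z ≫ q = (α_ X Y Z).hom ≫ X ◁ r ≫ s)
    (h' : p' ▷ Z' ≫ q' = (α_ X' Y' Z').hom ≫ X' ◁ r' ≫ s') :
    (tensorμ X X' Y Y' ≫ (p ⊗ₘ p')) ▷ (Z ⊗ Z') ≫ tensorμ P P' Z Z' ≫ (q ⊗ₘ q') =
      (α_ (X ⊗ X') (Y ⊗ Y') (Z ⊗ Z')).hom ≫
        (X ⊗ X') ◁ (tensorμ Y Y' Z Z' ≫ (r ⊗ₘ r')) ≫ tensorμ X X' R R' ≫ (s ⊗ₘ s') := by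
  simp only [comp_whiskerRight, MonoidalCategory.whiskerLeft_comp, Category.assoc]
  rw [tensorμ_natural_left_assoc, tensorHom_comp_tensorHom, h, h',
    ← tensorHom_comp_tensorHom, tensor_associativity_assoc, ← tensorHom_comp_tensorHom,
    tensorμ_natural_right_assoc]

/-- The monoidal product of two semigroups, with multiplication
`(AB)(AB) ⟶ (AA)(BB) ⟶ AB`. -/
abbrev Semigrp.tensor (A B : Semigrp C) : Semigrp C where
  X := A.X ⊗ B.X
  mul := tensorμ A.X B.X A.X B.X ≫ (A.mul ⊗ₘ B.mul)
  mul_assoc := tensor_square A.mul_assoc B.mul_assoc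

lemma braid_mul_left (A : Semigrp C) (B : C) :
    (β_ B A.X).inv ▷ A.X ≫ (α_ B A.X A.X).hom ≫ B ◁ A.mul ≫ (β_ B A.X).hom =
      (α_ A.X B A.X).hom ≫ A.X ◁ (β_ B A.X).hom ≫ (α_ A.X A.X B).inv ≫ A.mul ▷ B := by
  rw [BraidedCategory.braiding_naturality_right, BraidedCategory.braiding_tensor_right_hom]
  simp

lemma braid_mul_right (A : Semigrp C) (B : C) :
    A.X ◁ (β_ A.X B).inv ≫ (α_ A.X A.X B).inv ≫ A.mul ▷ B ≫ (β_ A.X B).hom =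
      (α_ A.X B A.X).inv ≫ (β_ A.X B).hom ▷ A.X ≫ (α_ B A.X A.X).hom ≫ B ◁ A.mul := by
  rw [BraidedCategory.braiding_naturality_left, BraidedCategory.braiding_tensor_left_hom]
  simp

lemma Semigrp.Nondegenerate.tensor {A B : Semigrp C} (hA : A.Nondegenerate)
    (hB : B.Nondegenerate) : (A.tensor B).Nondegenerate where
  right X Y := by
    change Function.Injective (fun f : X ⟶ Y ⊗ A.X ⊗ B.X =>
      f ▷ (A.X ⊗ B.X) ≫ (α_ Y (A.X ⊗ B.X) (A.X ⊗ B.X)).hom ≫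
            Y ◁ (tensorμ A.X B.X A.X B.X ≫ (A.mul ⊗ₘ B.mul)))
    have key : ∀ f : X ⟶ Y ⊗ A.X ⊗ B.X,
        f ▷ (A.X ⊗ B.X) ≫ (α_ Y (A.X ⊗ B.X) (A.X ⊗ B.X)).hom ≫
            Y ◁ (tensorμ A.X B.X A.X B.X ≫ (A.mul ⊗ₘ B.mul)) =
          (α_ X A.X B.X).inv ≫
            ((((f ≫ Y ◁ (β_ B.X A.X).inv ≫ (α_ Y B.X A.X).inv) ▷ A.X ≫
                (α_ (Y ⊗ B.X) A.X A.X).hom ≫ (Y ⊗ B.X) ◁ A.mul) ≫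
              (α_ Y B.X A.X).hom ≫ Y ◁ (β_ B.X A.X).hom ≫ (α_ Y A.X B.X).inv) ▷ B.X ≫
            (α_ (Y ⊗ A.X) B.X B.X).hom ≫ (Y ⊗ A.X) ◁ B.mul) ≫ (α_ Y A.X B.X).hom := by
      intro f
      have h := braid_mul_left A B.X
      calc _ = 𝟙 _ ⊗≫ f ▷ A.X ▷ B.X ⊗≫ Y ◁ ((α_ A.X B.X A.X).hom ≫ A.X ◁ (β_ B.X A.X).hom ≫
            (α_ A.X A.X B.X).inv ≫ A.mul ▷ B.X) ▷ B.X ⊗≫ Y ◁ A.X ◁ B.mul ⊗≫ 𝟙 _ := by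
            rw [tensorμ, MonoidalCategory.tensorHom_def]; monoidal
        _ = _ := by rw [← h]; monoidal
    intro f g h
    simp only [key] at h
    rw [cancel_epi, cancel_mono] at h
    have h1 := hB.right _ _ h
    rw [cancel_mono] at h1
    have h2 := hA.right _ _ h1
    rwa [cancel_mono] at h2
  left X Y := by
    change Function.Injective (fun g : X ⟶ (A.X ⊗ B.X) ⊗ Y =>
      (A.X ⊗ B.X) ◁ g ≫ (α_ (A.X ⊗ B.X) (A.X ⊗ B.X) Y).inv ≫
            (tensorμ A.X B.X A.X B.X ≫ (A.mul ⊗ₘ B.mul)) ▷ Y)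
    have key : ∀ g : X ⟶ (A.X ⊗ B.X) ⊗ Y,
        (A.X ⊗ B.X) ◁ g ≫ (α_ (A.X ⊗ B.X) (A.X ⊗ B.X) Y).inv ≫
            (tensorμ A.X B.X A.X B.X ≫ (A.mul ⊗ₘ B.mul)) ▷ Y =
          (α_ A.X B.X X).hom ≫
            (A.X ◁ ((B.X ◁ (g ≫ (β_ B.X A.X).inv ▷ Y ≫ (α_ B.X A.X Y).hom) ≫
                (α_ B.X B.X (A.X ⊗ Y)).inv ≫ B.mul ▷ (A.X ⊗ Y)) ≫
              (α_ B.X A.X Y).inv ≫ (β_ B.X A.X).hom ▷ Y ≫ (α_ A.X B.X Y).hom) ≫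
            (α_ A.X A.X (B.X ⊗ Y)).inv ≫ A.mul ▷ (B.X ⊗ Y)) ≫ (α_ A.X B.X Y).inv := by
      intro g
      have h := braid_mul_right B A.X
      calc _ = 𝟙 _ ⊗≫ A.X ◁ B.X ◁ g ⊗≫ A.X ◁ ((α_ B.X A.X B.X).inv ≫ (β_ B.X A.X).hom ▷ B.X ≫
            (α_ A.X B.X B.X).hom ≫ A.X ◁ B.mul) ▷ Y ⊗≫ A.mul ▷ B.X ▷ Y ⊗≫ 𝟙 _ := by
            rw [tensorμ, MonoidalCategory.tensorHom_def']; monoidal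
        _ = _ := by rw [← h]; monoidal
    intro f g h
    simp only [key] at h
    rw [cancel_epi, cancel_mono] at h
    have h1 := hA.left _ _ h
    rw [cancel_mono] at h1
    have h2 := hB.left _ _ h1
    rwa [cancel_mono] at h2

/-- The monoidal unit as a semigroup. -/
abbrev Semigrp.unit (C : Type u) [Category.{v} C] [MonoidalCategory C] : Semigrp C where
  X := 𝟙_ C
  mul := (λ_ (𝟙_ C)).hom
  mul_assoc := by monoidal

lemma Semigrp.unit_nondegenerate (C : Type u) [Category.{v} C] [MonoidalCategory C] :
    (Semigrp.unit C).Nondegenerate where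
  right X Y := by
    change Function.Injective (fun f : X ⟶ Y ⊗ 𝟙_ C =>
      f ▷ (𝟙_ C) ≫ (α_ Y (𝟙_ C) (𝟙_ C)).hom ≫ Y ◁ (λ_ (𝟙_ C)).hom)
    have key : ∀ f : X ⟶ Y ⊗ 𝟙_ C, f ▷ (𝟙_ C) ≫ (α_ Y (𝟙_ C) (𝟙_ C)).hom ≫
        Y ◁ (λ_ (𝟙_ C)).hom = (ρ_ X).hom ≫ f := by
      intro f; simp
    intro f g h
    simp only [key] at h
    rwa [cancel_epi] at h
  left X Y := by
    change Function.Injective (fun f : X ⟶ 𝟙_ C ⊗ Y =>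
      (𝟙_ C) ◁ f ≫ (α_ (𝟙_ C) (𝟙_ C) Y).inv ≫ (λ_ (𝟙_ C)).hom ▷ Y)
    have key : ∀ f : X ⟶ 𝟙_ C ⊗ Y, (𝟙_ C) ◁ f ≫ (α_ (𝟙_ C) (𝟙_ C) Y).inv ≫
        (λ_ (𝟙_ C)).hom ▷ Y = (λ_ X).hom ≫ f := by
      intro f; simp
    intro f g h
    simp only [key] at h
    rwa [cancel_epi] at h

/-- The monoidal product of `𝕄`-morphisms. -/
def MMor.tensor {A A' : C} {B B' : Semigrp C} (f : MMor A B) (f' : MMor A' B') :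
    MMor (A ⊗ A') (B.tensor B') where
  fst := tensorμ A A' B.X B'.X ≫ (f.fst ⊗ₘ f'.fst)
  snd := tensorμ B.X B'.X A A' ≫ (f.snd ⊗ₘ f'.snd)
  compat := tensor_square f.compat f'.compat

end Monoidality

section MonoidalM

variable {C : Type u} [Category.{v} C] [MonoidalCategory C] [BraidedCategory C]

lemma MMor.IsMultiplicative.tensor {A A' B B' : Semigrp C} {f : MMor A.X B} {f' : MMor A'.X B'}
    (hf : f.IsMultiplicative) (hf' : f'.IsMultiplicative) :
    MMor.IsMultiplicative (A := A.tensor A') (f.tensor f') where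
  fst := tensor_square hf.fst hf'.fst
  snd := tensor_square hf.snd hf'.snd

variable {Q : MorphismProperty C} [hQ : StandingAssumptions Q]

open StandingAssumptions

lemma tensorμ_comp_mem {X X' Y Y' Z Z' : C} {p : X ⊗ Y ⟶ Z} {p' : X' ⊗ Y' ⟶ Z'}
    (h : Q p) (h' : Q p') : Q (tensorμ X X' Y Y' ≫ (p ⊗ₘ p')) :=
  comp_mem _ _ (iso_mem _ ⟨tensorδ _ _ _ _, by simp, by simp⟩) (tensor_mem _ _ h h')

/-- The monoidal product of objects of `ℳ`. -/
abbrev MCat.tensor (A B : MCat Q) : MCat Q where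
  toSemigrp := A.toSemigrp.tensor B.toSemigrp
  nondeg := A.nondeg.tensor B.nondeg
  mul_mem := tensorμ_comp_mem A.mul_mem B.mul_mem

/-- The monoidal unit of `ℳ`. -/
abbrev MCat.unit (Q : MorphismProperty C) [hQ : StandingAssumptions Q] : MCat Q where
  toSemigrp := Semigrp.unit C
  nondeg := Semigrp.unit_nondegenerate C
  mul_mem := iso_mem _ (inferInstanceAs (IsIso (λ_ (𝟙_ C)).hom))

/-- The monoidal product of morphisms of `ℳ`. -/
def MHom.tensor {A A' B B' : MCat Q} (f : MHom A B) (f' : MHom A' B') :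
    MHom (A.tensor A') (B.tensor B') where
  mor := f.mor.tensor f'.mor
  mult := f.mult.tensor f'.mult
  dense := ⟨tensorμ_comp_mem f.dense.fst f'.dense.fst, tensorμ_comp_mem f.dense.snd f'.dense.snd⟩

/-- The morphism `φ^#` of `ℳ` induced by a multiplicative isomorphism `φ`. -/
def MIso.sharp {A B : MCat Q} (φ : MIso A B) : A ⟶ B where
  mor :=
    { fst := φ.iso.hom ▷ B.X ≫ B.mul
      snd := B.X ◁ φ.iso.hom ≫ B.mul
      compat := by
        have := B.toSemigrp.mul_assoc
        simp [this] }
  mult :=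
    { fst := by
        have := B.toSemigrp.mul_assoc
        dsimp only
        rw [← comp_whiskerRight_assoc, φ.map_mul, MonoidalCategory.tensorHom_def',
          MonoidalCategory.whiskerLeft_comp, Category.assoc]
        have h := whisker_exchange_assoc φ.iso.hom B.mul B.mul
        simp [this, h]
      snd := by
        have := B.toSemigrp.mul_assoc
        dsimp only
        rw [← MonoidalCategory.whiskerLeft_comp_assoc, φ.map_mul, MonoidalCategory.tensorHom_def,
          comp_whiskerRight, Category.assoc, ← whisker_exchange_assoc]
        simp [this] }
  dense := ⟨comp_mem _ _ (iso_mem _ inferInstance) B.mul_mem,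
    comp_mem _ _ (iso_mem _ inferInstance) B.mul_mem⟩

/-- The inverse of a multiplicative isomorphism. -/
def MIso.symm {A B : MCat Q} (φ : MIso A B) : MIso B A where
  iso := φ.iso.symm
  map_mul := by
    rw [Iso.symm_hom, Iso.comp_inv_eq, Category.assoc, φ.map_mul]
    simp

lemma MIso.comp_sharp_fst {Z A B : MCat Q} (f : Z ⟶ A) (φ : MIso A B) :
    (f ≫ φ.sharp).mor.fst = Z.X ◁ φ.iso.inv ≫ f.mor.fst ≫ φ.iso.hom := by
  apply MHom.comp_fst_eq
  have h := f.mor.fst_linear A.nondeg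
  have h' : φ.iso.hom ▷ B.X ≫ B.mul = A.X ◁ φ.iso.inv ≫ A.mul ≫ φ.iso.hom := by
    rw [φ.map_mul, MonoidalCategory.tensorHom_def']
    simp
  dsimp only [MIso.sharp]
  have h2 := h =≫ φ.iso.hom
  simp only [Category.assoc] at h2
  rw [h', ← whisker_exchange_assoc, h2]
  simp

lemma MIso.sharp_comp_fst {A B D : MCat Q} (φ : MIso A B) (g : B ⟶ D) :
    (φ.sharp ≫ g).mor.fst = φ.iso.hom ▷ D.X ≫ g.mor.fst := by
  apply MHom.comp_fst_eq
  dsimp only [MIso.sharp]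
  rw [comp_whiskerRight, Category.assoc, g.mult.fst]
  simp [whisker_exchange_assoc]

lemma MHom.fst_inj {A B : MCat Q} {f g : A ⟶ B} (h : f.mor.fst = g.mor.fst) : f = g :=
  MHom.ext_fst h

/-- The isomorphism of `ℳ` induced by a multiplicative isomorphism. -/
def MIso.sharpIso {A B : MCat Q} (φ : MIso A B) : A ≅ B where
  hom := φ.sharp
  inv := φ.symm.sharp
  hom_inv_id := MHom.fst_inj (by
    rw [MIso.sharp_comp_fst]
    simp [MIso.sharp, MIso.symm]
    rfl)
  inv_hom_id := MHom.fst_inj (by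
    rw [MIso.sharp_comp_fst]
    simp [MIso.sharp, MIso.symm]
    rfl)

/-- The identity, as a multiplicative isomorphism. -/
def MIso.refl (A : MCat Q) : MIso A A where
  iso := Iso.refl A.X
  map_mul := by simp

/-- Composition of multiplicative isomorphisms. -/
def MIso.trans {A B D : MCat Q} (φ : MIso A B) (ψ : MIso B D) : MIso A D where
  iso := φ.iso ≪≫ ψ.iso
  map_mul := by
    rw [Iso.trans_hom, ← Category.assoc, φ.map_mul, Category.assoc, ψ.map_mul,
      tensorHom_comp_tensorHom_assoc]

/-- The monoidal product of multiplicative isomorphisms. -/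
def MIso.tensor {A A' B B' : MCat Q} (φ : MIso A B) (ψ : MIso A' B') :
    MIso (A.tensor A') (B.tensor B') where
  iso := φ.iso ⊗ᵢ ψ.iso
  map_mul := by
    change (tensorμ _ _ _ _ ≫ (A.mul ⊗ₘ A'.mul)) ≫ (φ.iso.hom ⊗ₘ ψ.iso.hom) =
      ((φ.iso.hom ⊗ₘ ψ.iso.hom) ⊗ₘ (φ.iso.hom ⊗ₘ ψ.iso.hom)) ≫ tensorμ _ _ _ _ ≫
        (B.mul ⊗ₘ B'.mul)
    rw [tensorμ_natural_assoc, tensorHom_comp_tensorHom, ← φ.map_mul, ← ψ.map_mul, Category.assoc,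
      tensorHom_comp_tensorHom]

lemma MIso.sharp_congr {A B : MCat Q} {φ ψ : MIso A B} (h : φ.iso.hom = ψ.iso.hom) :
    φ.sharp = ψ.sharp :=
  MHom.fst_inj (by simp [MIso.sharp, h])

lemma MIso.refl_sharp (A : MCat Q) : (MIso.refl A).sharp = 𝟙 A :=
  MHom.fst_inj (by simp [MIso.sharp, MIso.refl]; rfl)

lemma MIso.sharp_comp_sharp {A B D : MCat Q} (φ : MIso A B) (ψ : MIso B D) :
    φ.sharp ≫ ψ.sharp = (φ.trans ψ).sharp :=
  MHom.fst_inj (by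
    rw [MIso.sharp_comp_fst]
    simp [MIso.sharp, MIso.trans])

lemma MIso.sharp_tensor_sharp {A A' B B' : MCat Q} (φ : MIso A B) (ψ : MIso A' B') :
    MHom.tensor φ.sharp ψ.sharp = (φ.tensor ψ).sharp :=
  MHom.fst_inj (by
    change tensorμ _ _ _ _ ≫ ((φ.iso.hom ▷ B.X ≫ B.mul) ⊗ₘ (ψ.iso.hom ▷ B'.X ≫ B'.mul)) =
      (φ.iso.hom ⊗ₘ ψ.iso.hom) ▷ (B.X ⊗ B'.X) ≫ tensorμ _ _ _ _ ≫ (B.mul ⊗ₘ B'.mul)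
    rw [tensorμ_natural_left_assoc, tensorHom_comp_tensorHom])

lemma tensor_assoc_square {X₁ X₂ X₃ Y₁ Y₂ Y₃ Z₁ Z₂ Z₃ : C} (p : X₁ ⊗ Y₁ ⟶ Z₁)
    (q : X₂ ⊗ Y₂ ⟶ Z₂) (r : X₃ ⊗ Y₃ ⟶ Z₃) :
    (tensorμ (X₁ ⊗ X₂) X₃ (Y₁ ⊗ Y₂) Y₃ ≫ ((tensorμ X₁ X₂ Y₁ Y₂ ≫ (p ⊗ₘ q)) ⊗ₘ r)) ≫
        (α_ Z₁ Z₂ Z₃).hom =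
      ((α_ X₁ X₂ X₃).hom ⊗ₘ (α_ Y₁ Y₂ Y₃).hom) ≫
        tensorμ X₁ (X₂ ⊗ X₃) Y₁ (Y₂ ⊗ Y₃) ≫ (p ⊗ₘ (tensorμ X₂ X₃ Y₂ Y₃ ≫ (q ⊗ₘ r))) := by
  have h := associator_monoidal_assoc X₁ X₂ X₃ Y₁ Y₂ Y₃ (p ⊗ₘ q ⊗ₘ r)
  rw [← id_tensorHom, tensorHom_comp_tensorHom, Category.id_comp] at h
  rw [← h, ← associator_naturality, ← tensorHom_id, tensorHom_comp_tensorHom_assoc, Category.id_comp,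
    Category.assoc]

lemma tensor_left_square {X Y Z : C} (p : X ⊗ Y ⟶ Z) :
    (tensorμ (𝟙_ C) X (𝟙_ C) Y ≫ ((λ_ (𝟙_ C)).hom ⊗ₘ p)) ≫ (λ_ Z).hom =
      ((λ_ X).hom ⊗ₘ (λ_ Y).hom) ≫ p := by
  rw [leftUnitor_monoidal, MonoidalCategory.tensorHom_def]
  simp

lemma tensor_right_square {X Y Z : C} (p : X ⊗ Y ⟶ Z) :
    (tensorμ X (𝟙_ C) Y (𝟙_ C) ≫ (p ⊗ₘ (λ_ (𝟙_ C)).hom)) ≫ (ρ_ Z).hom =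
      ((ρ_ X).hom ⊗ₘ (ρ_ Y).hom) ≫ p := by
  rw [rightUnitor_monoidal, MonoidalCategory.tensorHom_def']
  simp

/-- The associativity isomorphism, as a multiplicative isomorphism. -/
def MCat.assocIso (A B D : MCat Q) : MIso ((A.tensor B).tensor D) (A.tensor (B.tensor D)) where
  iso := α_ A.X B.X D.X
  map_mul := tensor_assoc_square A.mul B.mul D.mul

/-- The left unit isomorphism, as a multiplicative isomorphism. -/
def MCat.leftIso (A : MCat Q) : MIso ((MCat.unit Q).tensor A) A where
  iso := λ_ A.X
  map_mul := tensor_left_square A.mul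

/-- The right unit isomorphism, as a multiplicative isomorphism. -/
def MCat.rightIso (A : MCat Q) : MIso (A.tensor (MCat.unit Q)) A where
  iso := ρ_ A.X
  map_mul := tensor_right_square A.mul

/-- The monoidal structure of `ℳ`: the monoidal product of semigroups, with the associativity and
unit isomorphisms induced by those of the base category. -/
noncomputable instance MCat.monoidalStruct : MonoidalCategoryStruct (MCat Q) where
  tensorObj A B := A.tensor B
  tensorUnit := MCat.unit Q
  tensorHom f g := MHom.tensor f g
  whiskerLeft A _ _ g := MHom.tensor (𝟙 A) g
  whiskerRight f B := MHom.tensor f (𝟙 B)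
  associator A B D := (MCat.assocIso A B D).sharpIso
  leftUnitor A := (MCat.leftIso A).sharpIso
  rightUnitor A := (MCat.rightIso A).sharpIso

/-- The monoidal category `ℳ`. -/
noncomputable instance MCat.monoidalCategory : MonoidalCategory (MCat Q) :=
  MonoidalCategory.ofTensorHom
    (id_tensorHom_id := fun A B => rfl)
    (id_tensorHom := fun A _ _ f => rfl)
    (tensorHom_id := fun f B => rfl)
    (tensorHom_comp_tensorHom := fun {A B D A' B' D'} f f' g g' => MHom.fst_inj (by
      refine (MHom.comp_fst_eq _ _ ?_)
      exact tensor_square (MHom.isComposite_comp f g).fst (MHom.isComposite_comp f' g').fst))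
    (associator_naturality := fun {X₁ X₂ X₃ Y₁ Y₂ Y₃} f g h => MHom.fst_inj (by
      refine (MIso.comp_sharp_fst _ (MCat.assocIso Y₁ Y₂ Y₃)).trans
        (Eq.trans ?_ (MIso.sharp_comp_fst (MCat.assocIso X₁ X₂ X₃) _).symm)
      refine (whisker_eq _ (tensor_assoc_square f.mor.fst g.mor.fst h.mor.fst)).trans ?_
      exact whisker_iso_aux (α_ _ _ _) (α_ _ _ _) _))
    (leftUnitor_naturality := fun {X Y} f => MHom.fst_inj (by
      refine (MIso.comp_sharp_fst _ (MCat.leftIso Y)).trans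
        (Eq.trans ?_ (MIso.sharp_comp_fst (MCat.leftIso X) _).symm)
      refine (whisker_eq _ (tensor_left_square f.mor.fst)).trans ?_
      exact whisker_iso_aux (λ_ _) (λ_ _) _))
    (rightUnitor_naturality := fun {X Y} f => MHom.fst_inj (by
      refine (MIso.comp_sharp_fst _ (MCat.rightIso Y)).trans
        (Eq.trans ?_ (MIso.sharp_comp_fst (MCat.rightIso X) _).symm)
      refine (whisker_eq _ (tensor_right_square f.mor.fst)).trans ?_
      exact whisker_iso_aux (ρ_ _) (ρ_ _) _))
    (pentagon := fun A B D E => by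
      change MHom.tensor (MCat.assocIso A B D).sharp (𝟙 E) ≫
        (MCat.assocIso A (B.tensor D) E).sharp ≫ MHom.tensor (𝟙 A) (MCat.assocIso B D E).sharp =
        (MCat.assocIso (A.tensor B) D E).sharp ≫ (MCat.assocIso A B (D.tensor E)).sharp
      rw [← MIso.refl_sharp, ← MIso.refl_sharp]
      simp only [MIso.sharp_tensor_sharp, MIso.sharp_comp_sharp]
      apply MIso.sharp_congr
      change ((α_ A.X B.X D.X).hom ⊗ₘ 𝟙 E.X) ≫ (α_ A.X (B.X ⊗ D.X) E.X).hom ≫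
        (𝟙 A.X ⊗ₘ (α_ B.X D.X E.X).hom) =
        (α_ (A.X ⊗ B.X) D.X E.X).hom ≫ (α_ A.X B.X (D.X ⊗ E.X)).hom
      simp)
    (triangle := fun A B => by
      change (MCat.assocIso A (MCat.unit Q) B).sharp ≫ MHom.tensor (𝟙 A) (MCat.leftIso B).sharp =
        MHom.tensor (MCat.rightIso A).sharp (𝟙 B)
      rw [← MIso.refl_sharp, ← MIso.refl_sharp]
      simp only [MIso.sharp_tensor_sharp, MIso.sharp_comp_sharp]
      apply MIso.sharp_congr
      change (α_ A.X (𝟙_ C) B.X).hom ≫ (𝟙 A.X ⊗ₘ (λ_ B.X).hom) = (ρ_ A.X).hom ⊗ₘ 𝟙 B.X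
      simp)

end MonoidalM

section MultiplierBimonoids

variable {C : Type u} [Category.{v} C] [MonoidalCategory C] [BraidedCategory C]

/-- Counital fusion morphism `(A, t, e)` in the braided monoidal category: the fusion equation
`t1 . 1c . t1 . 1c⁻¹ . 1t = 1t . t1` and the counit condition `1e . t = 1e`. -/
structure IsCounitalFusion (A : C) (t : A ⊗ A ⟶ A ⊗ A) (e : A ⟶ 𝟙_ C) : Prop where
  fusion : A ◁ t ≫ A ◁ (β_ A A).inv ≫ (α_ A A A).inv ≫ t ▷ A ≫ (α_ A A A).hom ≫
      A ◁ (β_ A A).hom ≫ (α_ A A A).inv ≫ t ▷ A =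
    (α_ A A A).inv ≫ t ▷ A ≫ (α_ A A A).hom ≫ A ◁ t ≫ (α_ A A A).inv
  counit : t ≫ A ◁ e = A ◁ e

/-- Counital fusion morphism `(A, t, e)` in the braided monoidal category with the reversed
monoidal product: the fusion equation `1t . c1 . 1t . c⁻¹1 . t1 = t1 . 1t` and the counit
condition `e1 . t = e1`. -/
structure IsCounitalFusionRev (A : C) (t : A ⊗ A ⟶ A ⊗ A) (e : A ⟶ 𝟙_ C) : Prop where
  fusion : t ▷ A ≫ (β_ A A).inv ▷ A ≫ (α_ A A A).hom ≫ A ◁ t ≫ (α_ A A A).inv ≫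
      (β_ A A).hom ▷ A ≫ (α_ A A A).hom ≫ A ◁ t =
    (α_ A A A).hom ≫ A ◁ t ≫ (α_ A A A).inv ≫ t ▷ A ≫ (α_ A A A).hom
  counit : t ≫ e ▷ A = e ▷ A

/-- Multiplier bimonoid `(A, t₁, t₂, e)` in a braided monoidal category: both `(A, t₁, e)` and,
for the reversed monoidal product, `(A, t₂, e)` are counital fusion morphisms,
`t₂1 . 1t₁ = 1t₁ . t₂1`, and `e1 . t₁ = 1e . t₂`. -/
structure IsMultiplierBimonoid (A : C) (t₁ t₂ : A ⊗ A ⟶ A ⊗ A) (e : A ⟶ 𝟙_ C) : Prop where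
  fusion₁ : IsCounitalFusion A t₁ e
  fusion₂ : IsCounitalFusionRev A t₂ e
  compat : A ◁ t₁ ≫ (α_ A A A).inv ≫ t₂ ▷ A =
    (α_ A A A).inv ≫ t₂ ▷ A ≫ (α_ A A A).hom ≫ A ◁ t₁ ≫ (α_ A A A).inv
  mul_eq : t₁ ≫ e ▷ A ≫ (λ_ A).hom = t₂ ≫ A ◁ e ≫ (ρ_ A).hom

/-- The morphism `d₁ = m1 . 1c . t₁1 . 1c⁻¹`. -/
def comulFst {A : C} (m : A ⊗ A ⟶ A) (t₁ : A ⊗ A ⟶ A ⊗ A) : A ⊗ (A ⊗ A) ⟶ A ⊗ A :=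
  A ◁ (β_ A A).inv ≫ (α_ A A A).inv ≫ t₁ ▷ A ≫ (α_ A A A).hom ≫ A ◁ (β_ A A).hom ≫
    (α_ A A A).inv ≫ m ▷ A

/-- The morphism `d₂ = 1m . c1 . 1t₂ . c⁻¹1`. -/
def comulSnd {A : C} (m : A ⊗ A ⟶ A) (t₂ : A ⊗ A ⟶ A ⊗ A) : (A ⊗ A) ⊗ A ⟶ A ⊗ A :=
  (β_ A A).inv ▷ A ≫ (α_ A A A).hom ≫ A ◁ t₂ ≫ (α_ A A A).inv ≫ (β_ A A).hom ▷ A ≫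
    (α_ A A A).hom ≫ A ◁ m

end MultiplierBimonoids

end MultBimon

/-! By non-degeneracy a morphism of `ℳ` is determined by its first component, so the comonoid axioms
are equations between first components; the second components satisfy the mirror-image equations.
Everything is thus a comparison between `d₁` and `t₁`, where `d₁` is, up to a braiding, `act m t₁`:
apply `t₁`, then multiply the first output leg on the right by an extra factor.

A composite of the comultiplication with a product `g ⊗ h` is governed by the square relating `d₁`
followed by `g ⊗ h` to `g ⊗ h` followed by the candidate composite. If `g` is an associative action,
`whiskerRight_comulFst_tensorμ` pulls a copy of `g` to the front and leaves `act g` of `t₁` followed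
by `h` on its second leg; `whiskerLeft_tensorμ_comp` produces the same prefix on the other side. The
prefix is epi. When `g` is the multiplication, `act g` is then cancelled by non-degeneracy
(`act_injective`); when `g` is the counit or `d₁`, right linearity of `t₁` lets a copy of `m` be
cancelled instead. The outcome is a dictionary: right linearity of `d₁` corresponds to `1m . t₁1 =
t₁ . 1m`; the counit axioms to `e1 . t₁ = m` and `1e . t₁ = 1e`; coassociativity to the fusion
equation.

Conversely, applying `e` to single legs of the fusion equation recovers right linearity of `t₁` and
multiplicativity of `d₁`.

Compatibility of `d₁` with `d₂` is equivalent to `m1 . 1t₁ = 1m . t₂1` (`comul_compat_iff`). This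
weak relation follows from `t₂1 . 1t₁ = 1t₁ . t₂1` by applying `e` to the middle leg, and is
strengthened to it by `IsCounitalFusion.commute`, where fusion, multiplicativity and epimorphy of
`d₁` are used. All statements about `t₂` are those about `t₁` in the category with reversed product.
-/

namespace MultBimon

/-! ### Calculus of actions on one leg -/

section Act

variable {C : Type u} [Category.{v} C] [MonoidalCategory C] [BraidedCategory C]

/-- Apply `f : X ⟶ U ⊗ V`, move an extra tensor factor `B` past `V`, and apply
`g : U ⊗ B ⟶ D` to the first leg. -/
def act {X U V B D : C} (g : U ⊗ B ⟶ D) (f : X ⟶ U ⊗ V) : X ⊗ B ⟶ D ⊗ V :=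
  f ▷ B ≫ (α_ U V B).hom ≫ U ◁ (β_ V B).hom ≫ (α_ U B V).inv ≫ g ▷ V

lemma act_precomp {X X' U V B D : C} (g : U ⊗ B ⟶ D) (h : X' ⟶ X) (f : X ⟶ U ⊗ V) :
    act g (h ≫ f) = h ▷ B ≫ act g f := by
  simp [act]

lemma act_eq_id {X U V B D : C} (g : U ⊗ B ⟶ D) (f : X ⟶ U ⊗ V) :
    act g f = f ▷ B ≫ act g (𝟙 _) := by
  simp [act]

lemma act_whiskerLeft_comp {X U V B B' D : C} (b : B' ⟶ B) (g : U ⊗ B ⟶ D) (f : X ⟶ U ⊗ V) :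
    act (U ◁ b ≫ g) f = X ◁ b ≫ act g f := by
  simp only [act, comp_whiskerRight]
  simp only [← associator_inv_naturality_middle_assoc, ← whiskerLeft_comp_assoc,
    ← BraidedCategory.braiding_naturality_right, whisker_exchange_assoc]
  rw [whiskerLeft_comp_assoc, ← associator_naturality_right_assoc]

lemma act_postcomp {X U V B D D' : C} (g : U ⊗ B ⟶ D) (d : D ⟶ D') (f : X ⟶ U ⊗ V) :
    act (g ≫ d) f = act g f ≫ d ▷ V := by
  simp [act]

lemma act_comp_whiskerRight {X U U' V B D : C} (g : U' ⊗ B ⟶ D) (f : X ⟶ U ⊗ V) (w : U ⟶ U') :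
    act g (f ≫ w ▷ V) = act (w ▷ B ≫ g) f := by
  simp only [act, comp_whiskerRight, Category.assoc, associator_naturality_left_assoc,
    ← whisker_exchange_assoc, associator_inv_naturality_left_assoc]

lemma act_comp_whiskerLeft {X U V V' B D : C} (g : U ⊗ B ⟶ D) (f : X ⟶ U ⊗ V) (w : V ⟶ V') :
    act g (f ≫ U ◁ w) = act g f ≫ D ◁ w := by
  simp only [act, comp_whiskerRight, Category.assoc, ← whisker_exchange,
    associator_naturality_middle_assoc, ← whiskerLeft_comp_assoc,
    BraidedCategory.braiding_naturality_left]
  simp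

/-- By a hexagon identity, moving `B` and then `B'` past `V` is the same as moving `B ⊗ B'` past
`V`. -/
lemma act_act {X U V B B' D D' : C} (g : U ⊗ B ⟶ D) (g' : D ⊗ B' ⟶ D') (f : X ⟶ U ⊗ V) :
    act g' (act g f) = (α_ X B B').hom ≫ act ((α_ U B B').inv ≫ g ▷ B' ≫ g') f := by
  have h : (α_ V B B').hom ≫ (β_ V (B ⊗ B')).hom =
      (β_ V B).hom ▷ B' ≫ (α_ B V B').hom ≫ B ◁ (β_ V B').hom ≫ (α_ B B' V).inv := by
    rw [BraidedCategory.braiding_tensor_right_hom]; simp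
  calc _ = 𝟙 _ ⊗≫ f ▷ B ▷ B' ⊗≫ U ◁ (β_ V B).hom ▷ B' ⊗≫
        (g ▷ (V ⊗ B') ≫ D ◁ (β_ V B').hom) ⊗≫ g' ▷ V := by
          simp only [act]; monoidal
    _ = 𝟙 _ ⊗≫ f ▷ B ▷ B' ⊗≫ U ◁ ((β_ V B).hom ▷ B' ≫ (α_ B V B').hom ≫ B ◁ (β_ V B').hom ≫
        (α_ B B' V).inv) ⊗≫ g ▷ B' ▷ V ⊗≫ g' ▷ V := by
          rw [← whisker_exchange]; monoidal
    _ = _ := by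
          rw [← h]; simp only [act]; monoidal

lemma whiskerRight_tensorμ {X U V B E D W : C} (f : X ⟶ U ⊗ V) (g : U ⊗ B ⟶ D)
    (h : V ⊗ E ⟶ W) :
    f ▷ (B ⊗ E) ≫ tensorμ U V B E ≫ (g ⊗ₘ h) =
      (α_ X B E).inv ≫ act g f ▷ E ≫ (α_ D V E).hom ≫ D ◁ h := by
  rw [tensorμ, act, MonoidalCategory.tensorHom_def]; monoidal

/-- The two legs of `f` can be processed in either order. The price is a braiding of `B` and `E`,
absorbed by a hexagon identity and naturality of the braiding in `h`. -/
lemma act_whiskerRight {X U V B E D W : C} (f : X ⟶ U ⊗ V) (g : U ⊗ B ⟶ D)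
    (h : V ⊗ E ⟶ W) :
    (α_ X B E).inv ≫ act g f ▷ E ≫ (α_ D V E).hom ≫ D ◁ h =
      X ◁ (β_ E B).inv ≫ (α_ X E B).inv ≫ act g (f ▷ E ≫ (α_ U V E).hom ≫ U ◁ h) := by
  rw [← cancel_epi (X ◁ (β_ E B).hom), whiskerLeft_hom_inv_assoc]
  have hb : (α_ V E B).hom ≫ V ◁ (β_ E B).hom ≫ (α_ V B E).inv ≫ (β_ V B).hom ▷ E ≫
      (α_ B V E).hom ≫ B ◁ h = h ▷ B ≫ (β_ W B).hom := by
    rw [BraidedCategory.braiding_naturality_left, BraidedCategory.braiding_tensor_left_hom]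
    simp
  calc _ = 𝟙 _ ⊗≫ (X ◁ (β_ E B).hom ≫ f ▷ (B ⊗ E)) ⊗≫ U ◁ (β_ V B).hom ▷ E ⊗≫
        (g ▷ (V ⊗ E) ≫ D ◁ h) := by
          simp only [act]; monoidal
    _ = 𝟙 _ ⊗≫ f ▷ (E ⊗ B) ⊗≫ U ◁ ((α_ V E B).hom ≫ V ◁ (β_ E B).hom ≫ (α_ V B E).inv ≫
        (β_ V B).hom ▷ E ≫ (α_ B V E).hom ≫ B ◁ h) ⊗≫ g ▷ W := by
          rw [whisker_exchange, ← whisker_exchange g h]; monoidal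
    _ = _ := by
          rw [hb]; simp only [act]; monoidal

/-- A variant of non-degeneracy: the action on a middle tensor factor is faithful. -/
lemma Semigrp.Nondegenerate.act_middle_injective {S : Semigrp C} (hS : S.Nondegenerate)
    {X Z Y : C} {f g : X ⟶ Z ⊗ (S.X ⊗ Y)}
    (h : f ▷ S.X ≫ (α_ _ _ _).hom ≫ Z ◁ act S.mul (𝟙 _) =
      g ▷ S.X ≫ (α_ _ _ _).hom ≫ Z ◁ act S.mul (𝟙 _)) : f = g := by
  have hb : (β_ Y S.X).inv ▷ S.X ≫ (α_ _ _ _).hom ≫ Y ◁ S.mul ≫ (β_ Y S.X).hom =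
      act S.mul (𝟙 (S.X ⊗ Y)) := by
    rw [braid_mul_left]; simp [act]
  have key : ∀ f : X ⟶ Z ⊗ (S.X ⊗ Y),
      -- Braiding `Y` to the left of `S.X` makes the middle factor the last one, where the
      -- definition of non-degeneracy applies.
      ((f ≫ Z ◁ (β_ Y S.X).inv ≫ (α_ _ _ _).inv) ▷ S.X ≫ (α_ _ _ _).hom ≫ (Z ⊗ Y) ◁ S.mul) ≫
        (α_ _ _ _).hom ≫ Z ◁ (β_ Y S.X).hom =
      f ▷ S.X ≫ (α_ _ _ _).hom ≫ Z ◁ act S.mul (𝟙 _) := by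
    intro f
    rw [← hb]; monoidal
  rw [← key, ← key, cancel_mono] at h
  have := hS.right _ _ h
  rwa [cancel_mono] at this

lemma Semigrp.Nondegenerate.act_injective {S : Semigrp C} (hS : S.Nondegenerate)
    {X Y : C} {f g : X ⟶ S.X ⊗ Y} (h : act S.mul f = act S.mul g) : f = g := by
  rw [← cancel_mono (λ_ _).inv]
  apply hS.act_middle_injective
  have key : ∀ f : X ⟶ S.X ⊗ Y, (f ≫ (λ_ _).inv) ▷ S.X ≫ (α_ _ _ _).hom ≫
      𝟙_ C ◁ act S.mul (𝟙 _) = act S.mul f ≫ (λ_ _).inv := by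
    intro f
    rw [act_eq_id _ f]; monoidal
  rw [key, key, h]

lemma comulFst_eq {A : C} (m : A ⊗ A ⟶ A) (t : A ⊗ A ⟶ A ⊗ A) :
    comulFst m t = A ◁ (β_ A A).inv ≫ (α_ A A A).inv ≫ act m t := rfl

end Act

/-! ### Normal forms for composites with the comultiplication -/

section FirstComponent

variable {C : Type u} [Category.{v} C] [MonoidalCategory C] [BraidedCategory C]

lemma tensorμ_comp_tensor_braiding_inv {U V B E D W : C} (g : U ⊗ B ⟶ D) (h : V ⊗ E ⟶ W) :
    tensorμ U V B E ≫ (g ⊗ₘ h) ≫ (β_ W D).inv =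
      (β_ V U).inv ▷ (B ⊗ E) ≫ (α_ V U (B ⊗ E)).hom ≫
        V ◁ ((α_ U B E).inv ≫ (β_ E (U ⊗ B)).inv) ≫ (α_ V E (U ⊗ B)).inv ≫ (h ⊗ₘ g) := by
  have h1 : (g ⊗ₘ h) ≫ (β_ W D).inv = (β_ (V ⊗ E) (U ⊗ B)).inv ≫ (h ⊗ₘ g) := by
    rw [Iso.eq_inv_comp, ← BraidedCategory.braiding_naturality_assoc, Iso.hom_inv_id,
      Category.comp_id]
  rw [h1]
  simp only [← Category.assoc]
  congr 1
  rw [tensorμ, BraidedCategory.braiding_tensor_left_inv, BraidedCategory.braiding_tensor_right_inv V]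
  -- The inverse braiding of `V ⊗ E` with `U ⊗ B` undoes the crossing of `V` and `B` made by
  -- `tensorμ`.
  calc _ = 𝟙 _ ⊗≫ U ◁ ((β_ V B).hom ≫ (β_ V B).inv) ▷ E ⊗≫ (β_ V U).inv ▷ B ▷ E ⊗≫
        V ◁ (β_ E (U ⊗ B)).inv ⊗≫ 𝟙 _ := by monoidal
    _ = _ := by rw [Iso.hom_inv_id]; monoidal

/-- The reordering `a b c x y ↦ a c y b x` of tensor factors. -/
def reorder (X Y Z B E : C) : (X ⊗ (Y ⊗ Z)) ⊗ (B ⊗ E) ⟶ ((X ⊗ Z) ⊗ E) ⊗ (Y ⊗ B) :=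
  (X ◁ (β_ Z Y).inv ≫ (α_ X Z Y).inv) ▷ (B ⊗ E) ≫ (α_ (X ⊗ Z) Y (B ⊗ E)).hom ≫
    (X ⊗ Z) ◁ ((α_ Y B E).inv ≫ (β_ E (Y ⊗ B)).inv) ≫ (α_ (X ⊗ Z) E (Y ⊗ B)).inv

instance (X Y Z B E : C) : IsIso (reorder X Y Z B E) := by
  unfold reorder; infer_instance

/-- Since `g` is an associative action, acting by a product formed in the first leg of `d₁` is
acting twice. The inner action does not involve `t` and can be carried out at the start;
`act_whiskerRight` then moves `h` inside the outer one. -/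
lemma whiskerRight_comulFst_tensorμ {A B E W : C} {m : A ⊗ A ⟶ A} (t : A ⊗ A ⟶ A ⊗ A)
    {g : A ⊗ B ⟶ B} (hg : m ▷ B ≫ g = (α_ A A B).hom ≫ A ◁ g ≫ g) (h : A ⊗ E ⟶ W) :
    comulFst m t ▷ (B ⊗ E) ≫ tensorμ A A B E ≫ (g ⊗ₘ h) =
      reorder A A A B E ≫ ((A ⊗ A) ⊗ E) ◁ g ≫ act g (t ▷ E ≫ (α_ A A E).hom ≫ A ◁ h) := by
  have h1 : act g (act m t) = (α_ _ _ _).hom ≫ (A ⊗ A) ◁ g ≫ act g t := by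
    rw [act_act, hg, Iso.inv_hom_id_assoc, act_whiskerLeft_comp]
  have h2 := act_whiskerRight t (A ◁ g ≫ g) h
  rw [act_whiskerLeft_comp, act_whiskerLeft_comp] at h2
  rw [whiskerRight_tensorμ, comulFst_eq, ← Category.assoc (A ◁ _), act_precomp, h1, reorder]
  calc _ = 𝟙 _ ⊗≫ (A ◁ (β_ A A).inv ≫ (α_ A A A).inv) ▷ B ▷ E ⊗≫ ((α_ _ _ _).inv ≫
        ((A ⊗ A) ◁ g ≫ act g t) ▷ E ≫ (α_ B A E).hom ≫ B ◁ h) := by monoidal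
    _ = _ := by rw [h2]; monoidal

/-- Counterpart of `whiskerRight_comulFst_tensorμ`: the other side of a composition square acquires
the same prefix `reorder` followed by `g`, so that both can be cancelled. -/
lemma whiskerLeft_tensorμ_comp {A B D E W Z : C}
    (g : A ⊗ B ⟶ D) (h : A ⊗ E ⟶ W) (k : (A ⊗ W) ⊗ D ⟶ Z) :
    (α_ _ _ _).hom ≫ A ◁ (tensorμ A A B E ≫ (g ⊗ₘ h)) ≫ A ◁ (β_ W D).inv ≫ (α_ _ _ _).inv ≫ k =
      reorder A A A B E ≫ ((A ⊗ A) ⊗ E) ◁ g ≫ ((α_ A A E).hom ≫ A ◁ h) ▷ D ≫ k := by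
  rw [← whiskerLeft_comp_assoc, Category.assoc, tensorμ_comp_tensor_braiding_inv,
    MonoidalCategory.tensorHom_def', reorder]
  monoidal

end FirstComponent

/-! ### Epimorphisms stable under the monoidal product -/

section TensorEpi

variable {C : Type u} [Category.{v} C] [MonoidalCategory C]

/-- A morphism whose monoidal products with identity morphisms are epimorphisms. -/
def TensorEpi {Y Z : C} (q : Y ⟶ Z) : Prop := ∀ X W : C, Epi (X ◁ q ▷ W)

lemma TensorEpi.whiskerLeft {Y Z : C} {q : Y ⟶ Z} (h : TensorEpi q) (X : C) : Epi (X ◁ q) := by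
  have := h X (𝟙_ C)
  have e : X ◁ q = X ◁ (ρ_ Y).inv ≫ X ◁ q ▷ 𝟙_ C ≫ X ◁ (ρ_ Z).hom := by monoidal
  rw [e]; infer_instance

lemma TensorEpi.whisker {Y Z : C} {q : Y ⟶ Z} (h : TensorEpi q) (X W : C) :
    Epi ((X ◁ q) ▷ W) := by
  have := h X W
  have e : (X ◁ q) ▷ W = (α_ _ _ _).hom ≫ X ◁ q ▷ W ≫ (α_ _ _ _).inv := by monoidal
  rw [e]; infer_instance

lemma TensorEpi.iso_comp {Y Y' Z : C} (f : Y' ⟶ Y) [IsIso f] {q : Y ⟶ Z} (h : TensorEpi q) :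
    TensorEpi (f ≫ q) := fun X W => by
  have := h X W
  rw [comp_whiskerRight, MonoidalCategory.whiskerLeft_comp]
  infer_instance

end TensorEpi

/-! ### Dictionary between the comultiplication and the fusion morphism -/

section FirstComponent

variable {C : Type u} [Category.{v} C] [MonoidalCategory C] [BraidedCategory C]
  {S : Semigrp C} {t : S.X ⊗ S.X ⟶ S.X ⊗ S.X} {e : S.X ⟶ 𝟙_ C}

/-- The normal forms with `g = h = m`; what remains is an equation under `act m`, which is
injective. -/
lemma comulFst_linear_iff (hS : S.Nondegenerate) (hm : TensorEpi S.mul) :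
    comulFst S.mul t ▷ (S.X ⊗ S.X) ≫ (S.tensor S).mul =
        (α_ _ _ _).hom ≫ S.X ◁ (S.tensor S).mul ≫ comulFst S.mul t ↔
      t ▷ S.X ≫ (α_ _ _ _).hom ≫ S.X ◁ S.mul = (α_ _ _ _).hom ≫ S.X ◁ S.mul ≫ t := by
  have := hm.whiskerLeft ((S.X ⊗ S.X) ⊗ S.X)
  rw [whiskerRight_comulFst_tensorμ t S.mul_assoc, comulFst_eq, whiskerLeft_tensorμ_comp,
    cancel_epi, cancel_epi, ← act_precomp, Category.assoc]
  exact ⟨fun h => hS.act_injective h, fun h => by rw [h]⟩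

lemma act_braiding_inv {A : Semigrp C} :
    act A.mul (𝟙 (A.X ⊗ A.X)) ≫ (β_ A.X A.X).inv =
      (β_ A.X A.X).inv ▷ A.X ≫ (α_ _ _ _).hom ≫ A.X ◁ A.mul := by
  rw [Iso.comp_inv_eq]
  simp only [Category.assoc, braid_mul_left]
  simp [act]

lemma act_comulFst_mul :
    act S.mul (comulFst S.mul t) = (S.X ◁ (β_ S.X S.X).inv ≫ (α_ _ _ _).inv) ▷ S.X ≫
      (α_ _ _ _).hom ≫ (S.X ⊗ S.X) ◁ S.mul ≫ act S.mul t := by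
  rw [comulFst_eq, ← Category.assoc (S.X ◁ _), act_precomp, act_act, S.mul_assoc,
    Iso.inv_hom_id_assoc, act_whiskerLeft_comp]

/-- Multiplying the middle input of `d₁` on the right multiplies its first output leg on the right,
by associativity (`act_comulFst_mul`). This lets the iterated `d₁` be written under a single outer
`act m`. -/
lemma whiskerLeft_act_comp_comulFst {X : C} (f : X ⟶ S.X ⊗ S.X) :
    S.X ◁ act S.mul f ≫ comulFst S.mul t =
      (α_ _ _ _).inv ≫ act S.mul (S.X ◁ f ≫ comulFst S.mul t) := by
  rw [act_eq_id, act_precomp, act_comulFst_mul, comulFst_eq,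
    MonoidalCategory.whiskerLeft_comp_assoc, ← whiskerLeft_comp_assoc S.X (act _ _),
    act_braiding_inv]
  monoidal

lemma comulFst_multiplicative_iff (hS : S.Nondegenerate) :
    S.mul ▷ (S.X ⊗ S.X) ≫ comulFst S.mul t =
        (α_ _ _ _).hom ≫ S.X ◁ comulFst S.mul t ≫ comulFst S.mul t ↔
      S.mul ▷ S.X ≫ t = (α_ _ _ _).hom ≫ S.X ◁ t ≫ comulFst S.mul t := by
  have h1 : S.mul ▷ (S.X ⊗ S.X) ≫ comulFst S.mul t =
      ((S.X ⊗ S.X) ◁ (β_ _ _).inv ≫ (α_ _ _ _).inv) ≫ act S.mul (S.mul ▷ S.X ≫ t) := by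
    rw [comulFst_eq, act_precomp, ← whisker_exchange_assoc]; simp
  have h2 : (α_ _ _ _).hom ≫ S.X ◁ comulFst S.mul t ≫ comulFst S.mul t =
      ((S.X ⊗ S.X) ◁ (β_ _ _).inv ≫ (α_ _ _ _).inv) ≫
        act S.mul ((α_ _ _ _).hom ≫ S.X ◁ t ≫ comulFst S.mul t) := by
    have h3 : S.X ◁ comulFst S.mul t =
        S.X ◁ (S.X ◁ (β_ _ _).inv ≫ (α_ _ _ _).inv) ≫ S.X ◁ act S.mul t := by
      simp [comulFst_eq]
    rw [h3, Category.assoc, whiskerLeft_act_comp_comulFst, act_precomp, act_precomp,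
      act_precomp]
    monoidal
  rw [h1, h2, cancel_epi]
  exact ⟨fun h => hS.act_injective h, fun h => by rw [h]⟩

omit [BraidedCategory C] in
lemma unit_action_assoc (he : S.mul ≫ e = (e ⊗ₘ e) ≫ (λ_ _).hom) :
    S.mul ▷ 𝟙_ C ≫ (ρ_ S.X).hom ≫ e =
      (α_ S.X S.X (𝟙_ C)).hom ≫ S.X ◁ ((ρ_ S.X).hom ≫ e) ≫ (ρ_ S.X).hom ≫ e := by
  rw [rightUnitor_naturality_assoc, he, MonoidalCategory.tensorHom_def']
  simp [unitors_equal]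

omit [BraidedCategory C] in
lemma unit_action_assoc_right (he : S.mul ≫ e = (e ⊗ₘ e) ≫ (λ_ _).hom) :
    ((λ_ S.X).hom ≫ e) ▷ S.X ≫ (λ_ S.X).hom ≫ e =
      (α_ (𝟙_ C) S.X S.X).hom ≫ 𝟙_ C ◁ S.mul ≫ (λ_ S.X).hom ≫ e := by
  rw [leftUnitor_naturality_assoc, he, MonoidalCategory.tensorHom_def]
  simp

/-- The normal forms with `g` the action of `e` on the unit object and `h = m`. Here `act g` only
applies `e` to the first leg, so instead of non-degeneracy the right linearity `ht` is used: it
moves `m` in front of `t`, where it is cancelled as an epimorphism. -/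
lemma counit_left_iff (hm : TensorEpi S.mul) (he' : TensorEpi e)
    (he : S.mul ≫ e = (e ⊗ₘ e) ≫ (λ_ _).hom)
    (ht : t ▷ S.X ≫ (α_ _ _ _).hom ≫ S.X ◁ S.mul = (α_ _ _ _).hom ≫ S.X ◁ S.mul ≫ t) :
    comulFst S.mul t ▷ (𝟙_ C ⊗ S.X) ≫ tensorμ S.X S.X (𝟙_ C) S.X ≫
          (((ρ_ S.X).hom ≫ e) ⊗ₘ S.mul) =
        (α_ _ _ _).hom ≫ S.X ◁ (tensorμ S.X S.X (𝟙_ C) S.X ≫ (((ρ_ S.X).hom ≫ e) ⊗ₘ S.mul)) ≫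
          S.X ◁ (λ_ S.X).hom ≫ S.mul ≫ (λ_ S.X).inv ↔
      t ≫ e ▷ S.X ≫ (λ_ _).hom = S.mul := by
  -- The braiding with the unit object is trivial; it is inserted to match
  -- `whiskerLeft_tensorμ_comp`.
  have h1 : S.X ◁ (λ_ S.X).hom ≫ S.mul ≫ (λ_ S.X).inv = S.X ◁ (β_ S.X (𝟙_ C)).inv ≫
      (α_ _ _ _).inv ≫ (ρ_ _).hom ≫ S.mul ≫ (λ_ S.X).inv := by
    rw [braiding_inv_tensorUnit_right]
    monoidal
  have h2 : act ((ρ_ S.X).hom ≫ e) t = (ρ_ _).hom ≫ t ≫ e ▷ S.X := by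
    simp [act, braiding_tensorUnit_right]
  have := (he'.iso_comp (ρ_ S.X).hom).whiskerLeft ((S.X ⊗ S.X) ⊗ S.X)
  have : Epi (((α_ S.X S.X S.X).hom ≫ S.X ◁ S.mul) ▷ 𝟙_ C) := by
    have := hm.whisker S.X (𝟙_ C)
    rw [comp_whiskerRight]
    infer_instance
  rw [whiskerRight_comulFst_tensorμ t (unit_action_assoc he), h1, whiskerLeft_tensorμ_comp,
    cancel_epi, cancel_epi, ht, ← Category.assoc (α_ _ _ _).hom, act_precomp, h2, cancel_epi,
    cancel_epi]
  constructor
  · intro h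
    rw [← cancel_mono (λ_ _).inv, ← h]; simp
  · intro h
    rw [← h]; simp

lemma counit_right_iff (hS : S.Nondegenerate) (hm : TensorEpi S.mul) :
    comulFst S.mul t ▷ (S.X ⊗ 𝟙_ C) ≫ tensorμ S.X S.X S.X (𝟙_ C) ≫
          (S.mul ⊗ₘ ((ρ_ S.X).hom ≫ e)) =
        (α_ _ _ _).hom ≫ S.X ◁ (tensorμ S.X S.X S.X (𝟙_ C) ≫ (S.mul ⊗ₘ ((ρ_ S.X).hom ≫ e))) ≫
          S.X ◁ (ρ_ S.X).hom ≫ S.mul ≫ (ρ_ S.X).inv ↔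
      t ≫ S.X ◁ e = S.X ◁ e := by
  have h1 : S.X ◁ (ρ_ S.X).hom ≫ S.mul ≫ (ρ_ S.X).inv = S.X ◁ (β_ (𝟙_ C) S.X).inv ≫
      (α_ _ _ _).inv ≫ act S.mul (𝟙 _) := by
    simp [act, braiding_tensorUnit_left, braiding_inv_tensorUnit_left]
  have := hm.whiskerLeft ((S.X ⊗ S.X) ⊗ 𝟙_ C)
  rw [whiskerRight_comulFst_tensorμ t S.mul_assoc, h1, whiskerLeft_tensorμ_comp,
    cancel_epi, cancel_epi, ← act_precomp, Category.comp_id]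
  have key : t ▷ 𝟙_ C ≫ (α_ _ _ _).hom ≫ S.X ◁ ((ρ_ S.X).hom ≫ e) =
        (α_ _ _ _).hom ≫ S.X ◁ ((ρ_ S.X).hom ≫ e) ↔ t ≫ S.X ◁ e = S.X ◁ e := by
    rw [← cancel_epi (ρ_ (S.X ⊗ S.X)).hom]
    simp
  rw [← key]
  exact ⟨fun h => hS.act_injective h, fun h => by rw [h]⟩

/-- Identifies the first component of `(Δ ⊗ 1) • Δ`. Multiplicativity `hd'` makes `g = d₁` an
associative action, and `ht` again brings `h = m` to the front for cancellation. -/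
lemma coassoc_left_iff (hd : TensorEpi (comulFst S.mul t)) (hm : TensorEpi S.mul)
    (hd' : S.mul ▷ (S.X ⊗ S.X) ≫ comulFst S.mul t =
        (α_ _ _ _).hom ≫ S.X ◁ comulFst S.mul t ≫ comulFst S.mul t)
    (ht : t ▷ S.X ≫ (α_ _ _ _).hom ≫ S.X ◁ S.mul = (α_ _ _ _).hom ≫ S.X ◁ S.mul ≫ t)
    (k : S.X ⊗ ((S.X ⊗ S.X) ⊗ S.X) ⟶ (S.X ⊗ S.X) ⊗ S.X) :
    comulFst S.mul t ▷ ((S.X ⊗ S.X) ⊗ S.X) ≫ tensorμ S.X S.X (S.X ⊗ S.X) S.X ≫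
          (comulFst S.mul t ⊗ₘ S.mul) =
        (α_ _ _ _).hom ≫ S.X ◁ (tensorμ S.X S.X (S.X ⊗ S.X) S.X ≫
          (comulFst S.mul t ⊗ₘ S.mul)) ≫ k ↔
      k = S.X ◁ (β_ S.X (S.X ⊗ S.X)).inv ≫ (α_ _ _ _).inv ≫ act (comulFst S.mul t) t := by
  -- No loss of generality: the prefix is invertible.
  obtain ⟨k, rfl⟩ : ∃ k', S.X ◁ (β_ S.X (S.X ⊗ S.X)).inv ≫ (α_ _ _ _).inv ≫ k' = k :=
    ⟨(α_ _ _ _).hom ≫ S.X ◁ (β_ S.X (S.X ⊗ S.X)).hom ≫ k, by simp⟩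
  have := hd.whiskerLeft ((S.X ⊗ S.X) ⊗ S.X)
  have : Epi (((α_ S.X S.X S.X).hom ≫ S.X ◁ S.mul) ▷ (S.X ⊗ S.X)) := by
    have := hm.whisker S.X (S.X ⊗ S.X)
    rw [comp_whiskerRight]
    infer_instance
  rw [whiskerRight_comulFst_tensorμ t hd', whiskerLeft_tensorμ_comp,
    cancel_epi, cancel_epi, ht, ← Category.assoc (α_ _ _ _).hom, act_precomp, cancel_epi,
    cancel_epi, cancel_epi]
  exact eq_comm

lemma act_act_comp_associator {A X B V W D : C} (p : A ⊗ B ⟶ D) (x : X ⟶ (A ⊗ V) ⊗ W) :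
    act (act p (𝟙 _)) x ≫ (α_ _ _ _).hom = act p (x ≫ (α_ A V W).hom) := by
  have h : (α_ V W B).hom ≫ V ◁ (β_ W B).hom ≫ (α_ V B W).inv ≫ (β_ V B).hom ▷ W ≫
      (α_ B V W).hom = (β_ (V ⊗ W) B).hom := by
    rw [BraidedCategory.braiding_tensor_left_hom]
  calc _ = 𝟙 _ ⊗≫ x ▷ B ⊗≫ A ◁ ((α_ V W B).hom ≫ V ◁ (β_ W B).hom ≫ (α_ V B W).inv ≫
        (β_ V B).hom ▷ W ≫ (α_ B V W).hom) ⊗≫ p ▷ (V ⊗ W) ⊗≫ 𝟙 _ := by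
          simp only [act]; monoidal
    _ = _ := by rw [h]; simp only [act]; monoidal

/-- Right linearity of `t`, used for both copies of `t` on the left of the fusion equation: a factor
multiplied into the first leg of `f` emerges on the middle output leg. -/
lemma whiskerLeft_act_comp_fusion
    (ht : t ▷ S.X ≫ (α_ _ _ _).hom ≫ S.X ◁ S.mul = (α_ _ _ _).hom ≫ S.X ◁ S.mul ≫ t)
    {X : C} (f : X ⟶ S.X ⊗ S.X) :
    S.X ◁ act S.mul f ≫ S.X ◁ (β_ _ _).inv ≫ (α_ _ _ _).inv ≫ act t t ≫ (α_ _ _ _).hom =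
      (α_ _ _ _).inv ≫ (S.X ◁ f ≫ S.X ◁ (β_ _ _).inv ≫ (α_ _ _ _).inv ≫ act t t ≫
        (α_ _ _ _).hom) ▷ S.X ≫ (α_ _ _ _).hom ≫ S.X ◁ act S.mul (𝟙 _) := by
  have h1 : (S.X ⊗ S.X) ◁ S.mul ≫ act t t ≫ (α_ _ _ _).hom =
      (α_ _ _ _).inv ≫ (act t t ≫ (α_ _ _ _).hom) ▷ S.X ≫ (α_ _ _ _).hom ≫
        S.X ◁ act S.mul (𝟙 _) := by
    have h2 : (α_ _ _ _).inv ≫ t ▷ S.X ≫ (α_ _ _ _).hom ≫ S.X ◁ S.mul =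
        ((α_ _ _ _).inv ≫ t ▷ S.X ≫ 𝟙 _) ≫ (α_ _ _ _).hom ≫ S.X ◁ S.mul := by simp
    have h3 := act_act t (𝟙 ((S.X ⊗ S.X) ⊗ S.X)) t
    rw [← Iso.inv_comp_eq] at h3
    rw [← Iso.inv_comp_eq] at ht
    rw [← reassoc_of% (act_whiskerLeft_comp S.mul t t), ← ht, h2, act_postcomp, ← h3]
    simp only [act]
    monoidal
  rw [act_eq_id S.mul f, MonoidalCategory.whiskerLeft_comp_assoc,
    ← whiskerLeft_comp_assoc S.X (act _ _), act_braiding_inv]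
  calc _ = 𝟙 _ ⊗≫ S.X ◁ f ▷ S.X ⊗≫ S.X ◁ (β_ S.X S.X).inv ▷ S.X ⊗≫
        (S.X ⊗ S.X) ◁ S.mul ≫ act t t ≫ (α_ _ _ _).hom := by monoidal
    _ = _ := by rw [h1]; monoidal

/-- Both sides are the fusion equation followed by multiplication of the middle leg by an extra
factor, which `act_middle_injective` removes. -/
lemma comulFst_fusion_iff (hS : S.Nondegenerate)
    (ht : t ▷ S.X ≫ (α_ _ _ _).hom ≫ S.X ◁ S.mul = (α_ _ _ _).hom ≫ S.X ◁ S.mul ≫ t) :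
    t ▷ (S.X ⊗ S.X) ≫ (α_ _ _ _).hom ≫ S.X ◁ comulFst S.mul t =
        (α_ _ _ _).hom ≫ S.X ◁ comulFst S.mul t ≫
          S.X ◁ (β_ _ _).inv ≫ (α_ _ _ _).inv ≫ act t t ≫ (α_ _ _ _).hom ↔
      S.X ◁ t ≫ S.X ◁ (β_ _ _).inv ≫ (α_ _ _ _).inv ≫ act t t =
        (α_ _ _ _).inv ≫ t ▷ S.X ≫ (α_ _ _ _).hom ≫ S.X ◁ t ≫ (α_ _ _ _).inv := by
  have h1 : t ▷ (S.X ⊗ S.X) ≫ (α_ _ _ _).hom ≫ S.X ◁ comulFst S.mul t =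
      ((S.X ⊗ S.X) ◁ (β_ S.X S.X).inv ≫ (α_ _ _ _).inv) ≫
        (t ▷ S.X ≫ (α_ _ _ _).hom ≫ S.X ◁ t) ▷ S.X ≫ (α_ _ _ _).hom ≫
          S.X ◁ act S.mul (𝟙 _) := by
    rw [comulFst_eq, act_eq_id]
    calc _ = 𝟙 _ ⊗≫ (t ▷ (S.X ⊗ S.X) ≫ (S.X ⊗ S.X) ◁ (β_ S.X S.X).inv) ⊗≫
          S.X ◁ t ▷ S.X ⊗≫ S.X ◁ act S.mul (𝟙 _) := by monoidal
      _ = _ := by rw [← whisker_exchange]; monoidal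
  have h2 : (α_ _ _ _).hom ≫ S.X ◁ comulFst S.mul t ≫
        S.X ◁ (β_ _ _).inv ≫ (α_ _ _ _).inv ≫ act t t ≫ (α_ _ _ _).hom =
      ((S.X ⊗ S.X) ◁ (β_ S.X S.X).inv ≫ (α_ _ _ _).inv) ≫
        ((α_ _ _ _).hom ≫ S.X ◁ t ≫ S.X ◁ (β_ _ _).inv ≫ (α_ _ _ _).inv ≫ act t t ≫
          (α_ _ _ _).hom) ▷ S.X ≫ (α_ _ _ _).hom ≫ S.X ◁ act S.mul (𝟙 _) := by
    rw [comulFst_eq, MonoidalCategory.whiskerLeft_comp_assoc,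
      MonoidalCategory.whiskerLeft_comp_assoc, whiskerLeft_act_comp_fusion ht]
    monoidal
  rw [h1, h2, cancel_epi]
  have key : t ▷ S.X ≫ (α_ _ _ _).hom ≫ S.X ◁ t =
        (α_ _ _ _).hom ≫ S.X ◁ t ≫ S.X ◁ (β_ _ _).inv ≫ (α_ _ _ _).inv ≫ act t t ≫
          (α_ _ _ _).hom ↔
      S.X ◁ t ≫ S.X ◁ (β_ _ _).inv ≫ (α_ _ _ _).inv ≫ act t t =
        (α_ _ _ _).inv ≫ t ▷ S.X ≫ (α_ _ _ _).hom ≫ S.X ◁ t ≫ (α_ _ _ _).inv := by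
    rw [← cancel_epi (α_ S.X S.X S.X).inv, ← cancel_mono (α_ S.X S.X S.X).inv, eq_comm]
    simp
  rw [← key]
  exact ⟨fun h => hS.act_middle_injective h, fun h => by rw [h]⟩

/-- Exhibits the composite found in `coassoc_left_iff` as an `act m`, the form needed to compare it
with `(1 ⊗ Δ) • Δ`. -/
lemma iterated_comulFst :
    S.X ◁ (α_ S.X S.X S.X).inv ≫ (S.X ◁ (β_ S.X (S.X ⊗ S.X)).inv ≫ (α_ _ _ _).inv ≫
        act (comulFst S.mul t) t) ≫ (α_ _ _ _).hom =
      S.X ◁ (β_ (S.X ⊗ S.X) S.X).inv ≫ (α_ _ _ _).inv ≫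
        act S.mul (S.X ◁ (β_ _ _).inv ≫ (α_ _ _ _).inv ≫ act t t ≫ (α_ _ _ _).hom) := by
  have h1 : act (comulFst S.mul t) t = (S.X ⊗ S.X) ◁ (β_ S.X S.X).inv ≫ (α_ _ _ _).inv ≫
      act (act S.mul (𝟙 _)) (act t t) := by
    rw [comulFst_eq, act_whiskerLeft_comp, act_act, act_eq_id S.mul t, Iso.inv_hom_id_assoc]
  have h2 : (α_ _ _ _).inv ≫ (β_ S.X (S.X ⊗ S.X)).inv ≫ S.X ◁ (β_ S.X S.X).inv ≫
      (α_ _ _ _).inv = (β_ (S.X ⊗ S.X) S.X).inv ≫ (β_ S.X S.X).inv ▷ S.X := by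
    rw [← BraidedCategory.braiding_inv_naturality_right]
    rw [BraidedCategory.braiding_tensor_right_inv, BraidedCategory.braiding_tensor_left_inv]
    simp
  have h3 := act_act_comp_associator S.mul (act t t)
  rw [h1, ← Category.assoc (S.X ◁ (β_ S.X S.X).inv), act_precomp, ← h3]
  calc _ = 𝟙 _ ⊗≫ S.X ◁ ((α_ _ _ _).inv ≫ (β_ S.X (S.X ⊗ S.X)).inv ≫
        S.X ◁ (β_ S.X S.X).inv ≫ (α_ _ _ _).inv) ⊗≫ act (act S.mul (𝟙 _)) (act t t) ≫
          (α_ _ _ _).hom := by monoidal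
    _ = _ := by rw [h2]; monoidal

lemma coassoc_right_iff (hS : S.Nondegenerate) (hm : TensorEpi S.mul)
    (ht : t ▷ S.X ≫ (α_ _ _ _).hom ≫ S.X ◁ S.mul = (α_ _ _ _).hom ≫ S.X ◁ S.mul ≫ t) :
    comulFst S.mul t ▷ (S.X ⊗ (S.X ⊗ S.X)) ≫ tensorμ S.X S.X S.X (S.X ⊗ S.X) ≫
          (S.mul ⊗ₘ comulFst S.mul t) =
        (α_ _ _ _).hom ≫ S.X ◁ (tensorμ S.X S.X S.X (S.X ⊗ S.X) ≫
          (S.mul ⊗ₘ comulFst S.mul t)) ≫ S.X ◁ (α_ S.X S.X S.X).inv ≫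
          (S.X ◁ (β_ S.X (S.X ⊗ S.X)).inv ≫ (α_ _ _ _).inv ≫ act (comulFst S.mul t) t) ≫
            (α_ _ _ _).hom ↔
      S.X ◁ t ≫ S.X ◁ (β_ _ _).inv ≫ (α_ _ _ _).inv ≫ act t t =
        (α_ _ _ _).inv ≫ t ▷ S.X ≫ (α_ _ _ _).hom ≫ S.X ◁ t ≫ (α_ _ _ _).inv := by
  have := hm.whiskerLeft ((S.X ⊗ S.X) ⊗ (S.X ⊗ S.X))
  rw [iterated_comulFst, whiskerRight_comulFst_tensorμ t S.mul_assoc, whiskerLeft_tensorμ_comp,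
    cancel_epi, cancel_epi, ← act_precomp, Category.assoc, ← comulFst_fusion_iff hS ht]
  exact ⟨fun h => hS.act_injective h, fun h => by rw [h]⟩

/-- The equations between first components that make `(d, e)` the first components of the
comultiplication and counit of a comonoid in `ℳ`. -/
structure IsComonoidFst (S : Semigrp C) (d : S.X ⊗ (S.X ⊗ S.X) ⟶ S.X ⊗ S.X) (e : S.X ⟶ 𝟙_ C) :
    Prop where
  mul_comul : S.mul ▷ (S.X ⊗ S.X) ≫ d = (α_ _ _ _).hom ≫ S.X ◁ d ≫ d
  mul_counit : S.mul ≫ e = (e ⊗ₘ e) ≫ (λ_ _).hom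
  counit_left : d ▷ (𝟙_ C ⊗ S.X) ≫ tensorμ S.X S.X (𝟙_ C) S.X ≫
      (((ρ_ S.X).hom ≫ e) ⊗ₘ S.mul) =
    (α_ _ _ _).hom ≫ S.X ◁ (tensorμ S.X S.X (𝟙_ C) S.X ≫ (((ρ_ S.X).hom ≫ e) ⊗ₘ S.mul)) ≫
      S.X ◁ (λ_ S.X).hom ≫ S.mul ≫ (λ_ S.X).inv
  counit_right : d ▷ (S.X ⊗ 𝟙_ C) ≫ tensorμ S.X S.X S.X (𝟙_ C) ≫
      (S.mul ⊗ₘ ((ρ_ S.X).hom ≫ e)) =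
    (α_ _ _ _).hom ≫ S.X ◁ (tensorμ S.X S.X S.X (𝟙_ C) ≫ (S.mul ⊗ₘ ((ρ_ S.X).hom ≫ e))) ≫
      S.X ◁ (ρ_ S.X).hom ≫ S.mul ≫ (ρ_ S.X).inv
  coassoc : ∃ k : S.X ⊗ ((S.X ⊗ S.X) ⊗ S.X) ⟶ (S.X ⊗ S.X) ⊗ S.X,
    d ▷ ((S.X ⊗ S.X) ⊗ S.X) ≫ tensorμ S.X S.X (S.X ⊗ S.X) S.X ≫ (d ⊗ₘ S.mul) =
      (α_ _ _ _).hom ≫ S.X ◁ (tensorμ S.X S.X (S.X ⊗ S.X) S.X ≫ (d ⊗ₘ S.mul)) ≫ k ∧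
    d ▷ (S.X ⊗ (S.X ⊗ S.X)) ≫ tensorμ S.X S.X S.X (S.X ⊗ S.X) ≫ (S.mul ⊗ₘ d) =
      (α_ _ _ _).hom ≫ S.X ◁ (tensorμ S.X S.X S.X (S.X ⊗ S.X) ≫ (S.mul ⊗ₘ d)) ≫
        S.X ◁ (α_ S.X S.X S.X).inv ≫ k ≫ (α_ _ _ _).hom

/-! ### Counital fusion morphisms and first components of comonoids -/

lemma isCounitalFusion_iff {A : C} {t : A ⊗ A ⟶ A ⊗ A} {e : A ⟶ 𝟙_ C} :
    IsCounitalFusion A t e ↔ (A ◁ t ≫ A ◁ (β_ _ _).inv ≫ (α_ _ _ _).inv ≫ act t t =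
        (α_ _ _ _).inv ≫ t ▷ A ≫ (α_ _ _ _).hom ≫ A ◁ t ≫ (α_ _ _ _).inv) ∧
      t ≫ A ◁ e = A ◁ e :=
  ⟨fun h => ⟨h.fusion, h.counit⟩, fun h => ⟨h.1, h.2⟩⟩

lemma IsComonoidFst.isCounitalFusion (h : IsComonoidFst S (comulFst S.mul t) e)
    (hS : S.Nondegenerate) (hm : TensorEpi S.mul) (hd : TensorEpi (comulFst S.mul t))
    (ht : t ▷ S.X ≫ (α_ _ _ _).hom ≫ S.X ◁ S.mul = (α_ _ _ _).hom ≫ S.X ◁ S.mul ≫ t) :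
    IsCounitalFusion S.X t e := by
  obtain ⟨k, h1, h2⟩ := h.coassoc
  rw [coassoc_left_iff hd hm h.mul_comul ht] at h1
  rw [h1, coassoc_right_iff hS hm ht] at h2
  exact isCounitalFusion_iff.mpr ⟨h2, (counit_right_iff hS hm).mp h.counit_right⟩

lemma IsComonoidFst.comp_counit (h : IsComonoidFst S (comulFst S.mul t) e)
    (hm : TensorEpi S.mul) (he : TensorEpi e)
    (ht : t ▷ S.X ≫ (α_ _ _ _).hom ≫ S.X ◁ S.mul = (α_ _ _ _).hom ≫ S.X ◁ S.mul ≫ t) :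
    t ≫ e ▷ S.X ≫ (λ_ _).hom = S.mul :=
  (counit_left_iff hm he h.mul_counit ht).mp h.counit_left

/-- Apply `e` to the middle leg of the fusion equation. On the left, `1e . t = 1e` removes the outer
`t`, and `e` passes through the inverse braiding to turn the first `t` into `m`. -/
lemma IsCounitalFusion.right_linear (h : IsCounitalFusion S.X t e)
    (hm : t ≫ e ▷ S.X ≫ (λ_ _).hom = S.mul) :
    t ▷ S.X ≫ (α_ _ _ _).hom ≫ S.X ◁ S.mul = (α_ _ _ _).hom ≫ S.X ◁ S.mul ≫ t := by
  have h1 := (isCounitalFusion_iff.mp h).1 =≫ ((S.X ◁ e) ▷ S.X ≫ (ρ_ _).hom ▷ S.X)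
  have h2 : act t t ≫ (S.X ◁ e) ▷ S.X ≫ (ρ_ _).hom ▷ S.X =
      (S.X ⊗ S.X) ◁ e ≫ (ρ_ _).hom ≫ t := by
    have h3 := act_postcomp t (S.X ◁ e) t
    rw [h.counit] at h3
    have h4 := act_whiskerLeft_comp e (𝟙 _) t
    rw [Category.comp_id] at h4
    rw [← reassoc_of% h3, h4]
    simp [act, braiding_tensorUnit_right]
  have h5 : (β_ S.X S.X).inv ≫ S.X ◁ e = e ▷ S.X ≫ (λ_ _).hom ≫ (ρ_ _).inv := by
    rw [← BraidedCategory.braiding_inv_naturality_left, braiding_inv_tensorUnit_right]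
  simp only [Category.assoc, h2] at h1
  have h6 : S.X ◁ t ≫ S.X ◁ (β_ _ _).inv ≫ (α_ _ _ _).inv ≫ (S.X ⊗ S.X) ◁ e ≫ (ρ_ _).hom ≫ t =
      S.X ◁ S.mul ≫ t := by
    rw [← hm]
    calc _ = S.X ◁ t ≫ S.X ◁ ((β_ S.X S.X).inv ≫ S.X ◁ e) ≫ S.X ◁ (ρ_ _).hom ≫ t := by monoidal
      _ = _ := by rw [h5]; monoidal
  rw [h6] at h1
  rw [h1, ← hm]
  monoidal

/-- Apply `e` to the first leg of the fusion equation: on the left the outer `t` becomes `m`, which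
gives `d₁`; on the right the first `t` becomes `m`. -/
lemma IsCounitalFusion.mul_comp (h : IsCounitalFusion S.X t e)
    (hm : t ≫ e ▷ S.X ≫ (λ_ _).hom = S.mul) :
    S.mul ▷ S.X ≫ t = (α_ _ _ _).hom ≫ S.X ◁ t ≫ comulFst S.mul t := by
  have h1 := (isCounitalFusion_iff.mp h).1 =≫ ((e ▷ S.X ≫ (λ_ _).hom) ▷ S.X)
  have h2 := act_postcomp t (e ▷ S.X ≫ (λ_ _).hom) t
  rw [hm] at h2
  simp only [Category.assoc, ← h2, ← comulFst_eq] at h1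
  rw [h1, ← hm]
  calc _ = 𝟙 _ ⊗≫ t ▷ S.X ⊗≫ (e ▷ (S.X ⊗ S.X) ≫ 𝟙_ C ◁ t) ⊗≫ 𝟙 _ := by monoidal
    _ = _ := by rw [← whisker_exchange]; monoidal

lemma IsCounitalFusion.mul_counit (h : IsCounitalFusion S.X t e)
    (hm : t ≫ e ▷ S.X ≫ (λ_ _).hom = S.mul) :
    S.mul ≫ e = (e ⊗ₘ e) ≫ (λ_ _).hom := by
  calc _ = t ≫ (e ▷ S.X ≫ 𝟙_ C ◁ e) ≫ (λ_ _).hom := by rw [← hm]; simp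
    _ = t ≫ S.X ◁ e ≫ e ▷ 𝟙_ C ≫ (λ_ _).hom := by rw [← whisker_exchange]; simp
    _ = _ := by rw [reassoc_of% h.counit, MonoidalCategory.tensorHom_def', Category.assoc]

lemma IsCounitalFusion.mul_comul (h : IsCounitalFusion S.X t e) (hS : S.Nondegenerate)
    (hm : t ≫ e ▷ S.X ≫ (λ_ _).hom = S.mul) :
    S.mul ▷ (S.X ⊗ S.X) ≫ comulFst S.mul t =
        (α_ _ _ _).hom ≫ S.X ◁ comulFst S.mul t ≫ comulFst S.mul t :=
  (comulFst_multiplicative_iff hS).mpr (h.mul_comp hm)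

lemma IsCounitalFusion.isComonoidFst (h : IsCounitalFusion S.X t e)
    (hm : t ≫ e ▷ S.X ≫ (λ_ _).hom = S.mul) (hS : S.Nondegenerate)
    (hm' : TensorEpi S.mul) (hd : TensorEpi (comulFst S.mul t)) (he : TensorEpi e) :
    IsComonoidFst S (comulFst S.mul t) e := by
  have ht := h.right_linear hm
  refine ⟨h.mul_comul hS hm, h.mul_counit hm,
    (counit_left_iff hm' he (h.mul_counit hm) ht).mpr hm,
    (counit_right_iff hS hm').mpr h.counit,
    -- The witness is forced by the formula of `coassoc_left_iff`.
    _, (coassoc_left_iff hd hm' (h.mul_comul hS hm) ht _).mpr rfl, ?_⟩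
  exact (coassoc_right_iff hS hm' ht).mpr (isCounitalFusion_iff.mp h).1

end FirstComponent

/-! ### Compatibility of the two components -/

section Compatibility

variable {C : Type u} [Category.{v} C] [MonoidalCategory C] [BraidedCategory C]
  {S : Semigrp C} {t₁ t₂ : S.X ⊗ S.X ⟶ S.X ⊗ S.X}

/-- The left-handed counterpart of `act`: move an extra tensor factor past the first leg of `f`
and multiply it with the second leg. -/
def coact (S : Semigrp C) {X : C} (f : X ⟶ S.X ⊗ S.X) : S.X ⊗ X ⟶ S.X ⊗ S.X :=
  S.X ◁ f ≫ (α_ _ _ _).inv ≫ (β_ S.X S.X).hom ▷ S.X ≫ (α_ _ _ _).hom ≫ S.X ◁ S.mul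

lemma Semigrp.Nondegenerate.coact_injective (hS : S.Nondegenerate) {X : C}
    {f g : X ⟶ S.X ⊗ S.X} (h : coact S f = coact S g) : f = g := by
  have key : ∀ f : X ⟶ S.X ⊗ S.X, coact S f = (S.X ◁ (f ≫ (β_ _ _).inv) ≫ (α_ _ _ _).inv ≫
      S.mul ▷ S.X) ≫ (β_ _ _).hom := by
    intro f
    simp only [Category.assoc, MonoidalCategory.whiskerLeft_comp, braid_mul_right]
    rfl
  rw [key, key, cancel_mono] at h
  have := hS.left _ _ h
  rwa [cancel_mono] at this

lemma coact_precomp {X X' : C} (h : X' ⟶ X) (f : X ⟶ S.X ⊗ S.X) :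
    coact S (h ≫ f) = S.X ◁ h ≫ coact S f := by
  simp [coact]

lemma comulSnd_eq : comulSnd S.mul t₂ = (β_ _ _).inv ▷ S.X ≫ (α_ _ _ _).hom ≫ coact S t₂ := rfl

/-- Together, `coact` on the second leg and multiplication of the first leg on the left amount, up
to braidings, to left multiplication in the semigroup `S ⊗ S`. -/
lemma coact_act_whiskerLeft {X : C} (f : X ⟶ S.X ⊗ S.X) :
    coact S (act S.mul (S.X ◁ f ≫ (α_ _ _ _).inv ≫ S.mul ▷ S.X)) =
      S.X ◁ (α_ S.X X S.X).hom ≫ (α_ _ _ _).inv ≫ (β_ S.X S.X).hom ▷ (X ⊗ S.X) ≫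
        (S.X ⊗ S.X) ◁ act S.mul f ≫ tensorμ _ _ _ _ ≫ (S.mul ⊗ₘ S.mul) := by
  have h1 : act S.mul (S.X ◁ f ≫ (α_ _ _ _).inv ≫ S.mul ▷ S.X) =
      (α_ _ _ _).hom ≫ S.X ◁ act S.mul f ≫ (α_ _ _ _).inv ≫ S.mul ▷ S.X := by
    rw [← Category.assoc, act_comp_whiskerRight, S.mul_assoc, act]
    rw [act]
    monoidal
  have h2 : S.X ◁ S.mul ≫ (β_ S.X S.X).hom = (α_ _ _ _).inv ≫ (β_ _ _).hom ▷ S.X ≫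
      (α_ _ _ _).hom ≫ S.X ◁ (β_ _ _).hom ≫ (α_ _ _ _).inv ≫ S.mul ▷ S.X := by
    rw [BraidedCategory.braiding_naturality_right, BraidedCategory.braiding_tensor_right_hom]
    simp
  rw [h1, coact]
  calc _ = 𝟙 _ ⊗≫ S.X ◁ S.X ◁ act S.mul f ⊗≫ (S.X ◁ S.mul ≫ (β_ S.X S.X).hom) ▷ S.X ⊗≫
        S.X ◁ S.mul := by monoidal
    _ = 𝟙 _ ⊗≫ ((S.X ⊗ S.X) ◁ act S.mul f ≫ (β_ S.X S.X).hom ▷ (S.X ⊗ S.X)) ⊗≫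
        S.X ◁ (β_ S.X S.X).hom ▷ S.X ⊗≫ S.mul ▷ (S.X ⊗ S.X) ≫ S.X ◁ S.mul := by
        rw [h2]; monoidal
    _ = _ := by
        rw [whisker_exchange, tensorμ, MonoidalCategory.tensorHom_def]; monoidal

/-- Right multiplication on the first leg and left multiplication on the second do not interact. -/
lemma act_coact {X : C} (f : X ⟶ S.X ⊗ S.X) :
    act S.mul (coact S f) = (α_ _ _ _).hom ≫ coact S (act S.mul f) := by
  have h2 : (β_ S.X S.X).hom ▷ S.X ≫ act S.mul (𝟙 _) =
      (α_ _ _ _).hom ≫ S.X ◁ S.mul ≫ (β_ S.X S.X).hom := by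
    rw [BraidedCategory.braiding_naturality_right, BraidedCategory.braiding_tensor_right_hom]
    simp [act]
  have h3 : act (act S.mul (𝟙 _)) ((S.X ◁ f ≫ (α_ _ _ _).inv) ≫ (β_ S.X S.X).hom ▷ S.X) =
      (α_ _ _ _).hom ≫ S.X ◁ act S.mul f ≫ (α_ _ _ _).inv ≫ (β_ S.X S.X).hom ▷ S.X := by
    rw [act_comp_whiskerRight, h2, act, act]
    monoidal
  have h4 := act_act_comp_associator S.mul
    ((S.X ◁ f ≫ (α_ _ _ _).inv) ≫ (β_ S.X S.X).hom ▷ S.X)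
  rw [h3] at h4
  have h5 : coact S f = (((S.X ◁ f ≫ (α_ _ _ _).inv) ≫ (β_ S.X S.X).hom ▷ S.X) ≫
      (α_ _ _ _).hom) ≫ S.X ◁ S.mul := by simp [coact]
  rw [h5, act_comp_whiskerLeft, ← h4, coact]
  simp

/-- Mirror image of `coact_act_whiskerLeft`: right multiplication in `S ⊗ S`, split over the two
legs. -/
lemma coact_act_whiskerRight {X : C} (f : X ⟶ S.X ⊗ S.X) :
    S.X ◁ (α_ X S.X S.X).inv ≫ coact S (act S.mul (f ▷ S.X ≫ (α_ _ _ _).hom ≫ S.X ◁ S.mul)) =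
      (α_ _ _ _).inv ≫ (S.X ⊗ X) ◁ (β_ S.X S.X).hom ≫ coact S f ▷ (S.X ⊗ S.X) ≫
        tensorμ _ _ _ _ ≫ (S.mul ⊗ₘ S.mul) := by
  have h1 := act_whiskerRight f S.mul S.mul
  rw [← cancel_epi (X ◁ (β_ S.X S.X).hom), whiskerLeft_hom_inv_assoc] at h1
  have h2 : coact S (act S.mul f ▷ S.X ≫ (α_ _ _ _).hom ≫ S.X ◁ S.mul) =
      (α_ _ _ _).inv ≫ coact S (act S.mul f) ▷ S.X ≫ (α_ _ _ _).hom ≫ S.X ◁ S.mul := by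
    have h3 := S.mul_assoc
    rw [coact, coact]
    calc _ = 𝟙 _ ⊗≫ S.X ◁ act S.mul f ▷ S.X ⊗≫ ((β_ S.X S.X).hom ▷ (S.X ⊗ S.X) ≫
          (S.X ⊗ S.X) ◁ S.mul) ⊗≫ S.X ◁ S.mul := by rw [← whisker_exchange]; monoidal
      _ = 𝟙 _ ⊗≫ S.X ◁ act S.mul f ▷ S.X ⊗≫ (β_ S.X S.X).hom ▷ (S.X ⊗ S.X) ⊗≫
          S.X ◁ ((α_ _ _ _).hom ≫ S.X ◁ S.mul ≫ S.mul) := by monoidal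
      _ = _ := by rw [← h3]; monoidal
  rw [whiskerRight_tensorμ, act_coact, ← coact_precomp, ← h1, coact_precomp, coact_precomp, h2]
  monoidal

/-- Each side is the same isomorphism followed by `coact` of `act m` of a side of the simpler
equation, and both operations are injective. -/
lemma comul_compat_iff (hS : S.Nondegenerate) :
    comulSnd S.mul t₂ ▷ (S.X ⊗ S.X) ≫ (S.tensor S).mul =
        (α_ _ _ _).hom ≫ (S.X ⊗ S.X) ◁ comulFst S.mul t₁ ≫ (S.tensor S).mul ↔
      S.X ◁ t₁ ≫ (α_ _ _ _).inv ≫ S.mul ▷ S.X =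
        (α_ _ _ _).inv ≫ t₂ ▷ S.X ≫ (α_ _ _ _).hom ≫ S.X ◁ S.mul := by
  have h1 : comulSnd S.mul t₂ ▷ (S.X ⊗ S.X) ≫ (S.tensor S).mul =
      ((β_ S.X S.X).inv ▷ S.X ≫ (α_ _ _ _).hom) ▷ (S.X ⊗ S.X) ≫ (S.X ⊗ (S.X ⊗ S.X)) ◁ (β_ _ _).inv ≫
        (α_ _ _ _).hom ≫ S.X ◁ (α_ _ _ _).inv ≫ S.X ◁ (α_ _ _ _).hom ▷ S.X ≫
          coact S (act S.mul ((α_ _ _ _).inv ≫ t₂ ▷ S.X ≫ (α_ _ _ _).hom ≫ S.X ◁ S.mul)) := by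
    have h := coact_act_whiskerRight (S := S) t₂
    rw [act_precomp, coact_precomp, comulSnd_eq]
    calc _ = ((β_ S.X S.X).inv ▷ S.X ≫ (α_ _ _ _).hom) ▷ (S.X ⊗ S.X) ≫ coact S t₂ ▷ (S.X ⊗ S.X) ≫
          tensorμ _ _ _ _ ≫ (S.mul ⊗ₘ S.mul) := by monoidal
      _ = ((β_ S.X S.X).inv ▷ S.X ≫ (α_ _ _ _).hom) ▷ (S.X ⊗ S.X) ≫
          (S.X ⊗ (S.X ⊗ S.X)) ◁ (β_ _ _).inv ≫ (α_ _ _ _).hom ≫ S.X ◁ (α_ _ _ _).inv ≫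
          coact S (act S.mul (t₂ ▷ S.X ≫ (α_ _ _ _).hom ≫ S.X ◁ S.mul)) := by
          rw [h]; simp
      _ = _ := by monoidal
  have h2 : (α_ _ _ _).hom ≫ (S.X ⊗ S.X) ◁ comulFst S.mul t₁ ≫ (S.tensor S).mul =
      ((β_ S.X S.X).inv ▷ S.X ≫ (α_ _ _ _).hom) ▷ (S.X ⊗ S.X) ≫ (S.X ⊗ (S.X ⊗ S.X)) ◁ (β_ _ _).inv ≫
        (α_ _ _ _).hom ≫ S.X ◁ (α_ _ _ _).inv ≫ S.X ◁ (α_ _ _ _).hom ▷ S.X ≫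
          coact S (act S.mul (S.X ◁ t₁ ≫ (α_ _ _ _).inv ≫ S.mul ▷ S.X)) := by
    rw [coact_act_whiskerLeft, comulFst_eq]
    calc _ = 𝟙 _ ⊗≫ (S.X ⊗ S.X) ◁ S.X ◁ (β_ S.X S.X).inv ⊗≫ (S.X ⊗ S.X) ◁ act S.mul t₁ ⊗≫
          tensorμ _ _ _ _ ≫ (S.mul ⊗ₘ S.mul) := by monoidal
      _ = 𝟙 _ ⊗≫ (S.X ⊗ S.X) ◁ S.X ◁ (β_ S.X S.X).inv ⊗≫
          ((β_ S.X S.X).inv ≫ (β_ S.X S.X).hom) ▷ ((S.X ⊗ S.X) ⊗ S.X) ⊗≫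
          (S.X ⊗ S.X) ◁ act S.mul t₁ ⊗≫ tensorμ _ _ _ _ ≫ (S.mul ⊗ₘ S.mul) := by
          rw [Iso.inv_hom_id]; monoidal
      _ = 𝟙 _ ⊗≫ ((S.X ⊗ S.X) ◁ (S.X ◁ (β_ S.X S.X).inv) ≫
            (β_ S.X S.X).inv ▷ (S.X ⊗ (S.X ⊗ S.X))) ⊗≫
          (β_ S.X S.X).hom ▷ ((S.X ⊗ S.X) ⊗ S.X) ⊗≫
          (S.X ⊗ S.X) ◁ act S.mul t₁ ⊗≫ tensorμ _ _ _ _ ≫ (S.mul ⊗ₘ S.mul) := by monoidal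
      _ = _ := by rw [whisker_exchange]; monoidal
  rw [h1, h2, cancel_epi, cancel_epi, cancel_epi, cancel_epi, cancel_epi]
  constructor
  · intro h
    exact (hS.act_injective (hS.coact_injective h)).symm
  · intro h
    rw [h]

variable {e : S.X ⟶ 𝟙_ C}

/-- Multiply the middle leg by an extra factor, which is faithful, and precompose with `1 ⊗ 1 ⊗ d₁`,
which is epi. The side ending in `t₂` is rewritten by `hc` so that it ends in `m`; fusion then
absorbs the precomposed `d₁`, `hc` is used a second time to restore `t₂`, and multiplicativity of
`d₁` produces the other side. -/
lemma IsCounitalFusion.commute (h : IsCounitalFusion S.X t₁ e) (hS : S.Nondegenerate)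
    (hd : TensorEpi (comulFst S.mul t₁))
    (ht : t₁ ▷ S.X ≫ (α_ _ _ _).hom ≫ S.X ◁ S.mul = (α_ _ _ _).hom ≫ S.X ◁ S.mul ≫ t₁)
    (hd' : S.mul ▷ (S.X ⊗ S.X) ≫ comulFst S.mul t₁ =
        (α_ _ _ _).hom ≫ S.X ◁ comulFst S.mul t₁ ≫ comulFst S.mul t₁)
    (hc : S.X ◁ t₁ ≫ (α_ _ _ _).inv ≫ S.mul ▷ S.X =
        (α_ _ _ _).inv ≫ t₂ ▷ S.X ≫ (α_ _ _ _).hom ≫ S.X ◁ S.mul) :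
    S.X ◁ t₁ ≫ (α_ _ _ _).inv ≫ t₂ ▷ S.X =
      (α_ _ _ _).inv ≫ t₂ ▷ S.X ≫ (α_ _ _ _).hom ≫ S.X ◁ t₁ ≫ (α_ _ _ _).inv := by
  have hf := (comulFst_fusion_iff hS ht).mpr (isCounitalFusion_iff.mp h).1
  rw [← cancel_mono (α_ S.X S.X S.X).hom]
  apply hS.act_middle_injective
  -- The isomorphism that moves the extra factor to the position it has in the definition of `d₁`.
  set P : S.X ⊗ (S.X ⊗ (S.X ⊗ S.X)) ⟶ (S.X ⊗ (S.X ⊗ S.X)) ⊗ S.X :=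
    S.X ◁ (S.X ◁ (β_ S.X S.X).inv ≫ (α_ _ _ _).inv) ≫ (α_ _ _ _).inv with hP
  have h1 : P ≫ ((S.X ◁ t₁ ≫ (α_ _ _ _).inv ≫ t₂ ▷ S.X) ≫ (α_ _ _ _).hom) ▷ S.X ≫
      (α_ _ _ _).hom ≫ S.X ◁ act S.mul (𝟙 _) =
      S.X ◁ (S.X ◁ (β_ S.X S.X).inv ≫ (α_ _ _ _).inv ≫ act t₁ t₁ ≫ (α_ _ _ _).hom) ≫
        (α_ _ _ _).inv ≫ S.mul ▷ (S.X ⊗ S.X) := by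
    rw [act, act]
    calc _ = P ⊗≫ (S.X ◁ t₁) ▷ S.X ⊗≫ (t₂ ▷ (S.X ⊗ S.X) ≫ (S.X ⊗ S.X) ◁ (β_ S.X S.X).hom) ⊗≫
          S.X ◁ S.mul ▷ S.X := by monoidal
      _ = P ⊗≫ (S.X ◁ t₁) ▷ S.X ⊗≫ S.X ◁ S.X ◁ (β_ S.X S.X).hom ⊗≫
          ((α_ _ _ _).inv ≫ t₂ ▷ S.X ≫ (α_ _ _ _).hom ≫ S.X ◁ S.mul) ▷ S.X ⊗≫ 𝟙 _ := by
          rw [← whisker_exchange]; monoidal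
      _ = _ := by rw [← hc, hP]; monoidal
  have h2 : P ≫ (((α_ _ _ _).inv ≫ t₂ ▷ S.X ≫ (α_ _ _ _).hom ≫ S.X ◁ t₁ ≫ (α_ _ _ _).inv) ≫
      (α_ _ _ _).hom) ▷ S.X ≫ (α_ _ _ _).hom ≫ S.X ◁ act S.mul (𝟙 _) =
      (α_ _ _ _).inv ≫ t₂ ▷ (S.X ⊗ S.X) ≫ (α_ _ _ _).hom ≫ S.X ◁ comulFst S.mul t₁ := by
    rw [comulFst_eq, act_eq_id S.mul t₁]
    calc _ = 𝟙 _ ⊗≫ ((S.X ⊗ S.X) ◁ (β_ S.X S.X).inv ≫ t₂ ▷ (S.X ⊗ S.X)) ⊗≫ S.X ◁ t₁ ▷ S.X ⊗≫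
          S.X ◁ act S.mul (𝟙 _) := by monoidal
      _ = _ := by rw [whisker_exchange]; monoidal
  have : Epi (S.X ◁ S.X ◁ comulFst S.mul t₁) := by
    have := hd.whiskerLeft (S.X ⊗ S.X)
    have he : S.X ◁ S.X ◁ comulFst S.mul t₁ =
      (α_ _ _ _).inv ≫ (S.X ⊗ S.X) ◁ comulFst S.mul t₁ ≫ (α_ _ _ _).hom := by monoidal
    rw [he]; infer_instance
  have hPi : IsIso P := by rw [hP]; infer_instance
  rw [← cancel_epi P, h1, h2, ← cancel_epi (S.X ◁ S.X ◁ comulFst S.mul t₁)]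
  have h3 := congrArg (S.X ◁ ·) ((α_ _ _ _).inv ≫= hf)
  simp only [Iso.inv_hom_id_assoc] at h3
  rw [MonoidalCategory.whiskerLeft_comp S.X (S.X ◁ _)] at h3
  rw [← reassoc_of% h3]
  have h4 := (α_ _ _ _).inv ≫= hd'
  have h5 := congrArg (· ▷ (S.X ⊗ S.X)) hc
  rw [Iso.inv_hom_id_assoc] at h4
  simp only [comp_whiskerRight] at h5
  calc _ = 𝟙 _ ⊗≫ (S.X ◁ t₁) ▷ (S.X ⊗ S.X) ⊗≫
        ((S.X ⊗ S.X) ◁ comulFst S.mul t₁ ≫ S.mul ▷ (S.X ⊗ S.X)) := by monoidal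
    _ = 𝟙 _ ⊗≫ ((S.X ◁ t₁) ▷ (S.X ⊗ S.X) ≫ (α_ S.X S.X S.X).inv ▷ (S.X ⊗ S.X) ≫
          S.mul ▷ S.X ▷ (S.X ⊗ S.X)) ⊗≫ S.X ◁ comulFst S.mul t₁ := by
        rw [whisker_exchange]; monoidal
    _ = 𝟙 _ ⊗≫ t₂ ▷ (S.X ⊗ (S.X ⊗ S.X)) ⊗≫ S.X ◁ ((α_ _ _ _).inv ≫ S.mul ▷ (S.X ⊗ S.X) ≫
          comulFst S.mul t₁) := by
        rw [h5]; monoidal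
    _ = 𝟙 _ ⊗≫ (t₂ ▷ (S.X ⊗ (S.X ⊗ S.X)) ≫ (S.X ⊗ S.X) ◁ comulFst S.mul t₁) ⊗≫
          S.X ◁ comulFst S.mul t₁ := by
        rw [h4]; monoidal
    _ = _ := by rw [← whisker_exchange]; monoidal

-- Apply `e` to the middle leg of `hc`: it turns `t₂` into `m` on one side and `t₁` into `m` on the
-- other.
omit [BraidedCategory C] in
lemma compat_of_commute
    (h₁ : t₁ ≫ e ▷ S.X ≫ (λ_ _).hom = S.mul) (h₂ : t₂ ≫ S.X ◁ e ≫ (ρ_ _).hom = S.mul)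
    (hc : S.X ◁ t₁ ≫ (α_ _ _ _).inv ≫ t₂ ▷ S.X =
      (α_ _ _ _).inv ≫ t₂ ▷ S.X ≫ (α_ _ _ _).hom ≫ S.X ◁ t₁ ≫ (α_ _ _ _).inv) :
    S.X ◁ t₁ ≫ (α_ _ _ _).inv ≫ S.mul ▷ S.X =
        (α_ _ _ _).inv ≫ t₂ ▷ S.X ≫ (α_ _ _ _).hom ≫ S.X ◁ S.mul := by
  have h := hc =≫ (S.X ◁ e ≫ (ρ_ _).hom) ▷ S.X
  simp only [Category.assoc] at h
  rw [← comp_whiskerRight, h₂] at h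
  rw [h, ← h₁]
  monoidal

end Compatibility

/-! ### Passage to the reversed monoidal product -/

section Opposite

variable {C : Type u} [Category.{v} C] [MonoidalCategory C] [BraidedCategory C]

open MonoidalOpposite

/-- A semigroup, regarded in the category with the reversed monoidal product. -/
def Semigrp.mop (S : Semigrp C) : Semigrp Cᴹᵒᵖ where
  X := .mop S.X
  mul := S.mul.mop
  mul_assoc := by
    apply Quiver.Hom.unmop_inj
    have := S.mul_assoc
    simp [this]

omit [BraidedCategory C] in
lemma Semigrp.Nondegenerate.mop {S : Semigrp C} (hS : S.Nondegenerate) : S.mop.Nondegenerate where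
  right X Y _ _ h := Quiver.Hom.unmop_inj (hS.left X.unmop Y.unmop (congrArg Quiver.Hom.unmop h))
  left X Y _ _ h := Quiver.Hom.unmop_inj (hS.right X.unmop Y.unmop (congrArg Quiver.Hom.unmop h))

omit [BraidedCategory C] in
lemma TensorEpi.mop {Y Z : C} {q : Y ⟶ Z} (h : TensorEpi q) : TensorEpi q.mop := fun X W => by
  have := h.whisker W.unmop X.unmop
  exact ⟨fun f g hfg => Quiver.Hom.unmop_inj
    ((cancel_epi ((W.unmop ◁ q) ▷ X.unmop)).mp (congrArg Quiver.Hom.unmop hfg))⟩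

/-- The middle-four interchange is self-dual only up to rebracketing, unlike the other structure
used here, so it has to be rewritten explicitly when equations are transported. -/
lemma unmop_tensorμ (X₁ X₂ Y₁ Y₂ : Cᴹᵒᵖ) :
    (tensorμ X₁ X₂ Y₁ Y₂).unmop = tensorμ Y₂.unmop Y₁.unmop X₂.unmop X₁.unmop := by
  simp [tensorμ]

lemma isCounitalFusion_mop_iff {A : C} {t : A ⊗ A ⟶ A ⊗ A} {e : A ⟶ 𝟙_ C} :
    IsCounitalFusion (MonoidalOpposite.mop A) t.mop e.mop ↔ IsCounitalFusionRev A t e :=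
  ⟨fun h => ⟨congrArg Quiver.Hom.unmop h.fusion, congrArg Quiver.Hom.unmop h.counit⟩,
    fun h => ⟨Quiver.Hom.unmop_inj h.fusion, Quiver.Hom.unmop_inj h.counit⟩⟩

end Opposite

/-! ### Comonoids in `ℳ` and multiplier bimonoids -/

section Comonoids

variable {C : Type u} [Category.{v} C] [MonoidalCategory C] [BraidedCategory C]
  {Q : MorphismProperty C} [hQ : StandingAssumptions Q]

open StandingAssumptions MonoidalOpposite

lemma tensorEpi_of_mem {Y Z : C} {q : Y ⟶ Z} (h : Q q) : TensorEpi q := fun X W =>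
  epi_of_mem (whiskerLeft_mem X (whiskerRight_mem W h))

lemma IsComposite.snd_eq {A : C} {B D : Semigrp C} {f : MMor A B} {g : MMor B.X D}
    {h : MMor A D} (H : IsComposite f g h) (hg' : g.IsDense Q) {k : D.X ⊗ A ⟶ D.X}
    (hk : g.snd ▷ A ≫ k = (α_ D.X B.X A).hom ≫ D.X ◁ f.snd ≫ g.snd) : h.snd = k := by
  have := epi_of_mem (whiskerRight_mem A hg'.snd)
  rw [← cancel_epi (g.snd ▷ A), hk, H.snd]

lemma MIso.symm_sharp_fst {A B : MCat Q} (φ : MIso A B) :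
    φ.symm.sharp.mor.fst = B.X ◁ φ.iso.hom ≫ B.mul ≫ φ.iso.inv := by
  have h : A.mul = (φ.iso.hom ⊗ₘ φ.iso.hom) ≫ B.mul ≫ φ.iso.inv := by
    rw [← reassoc_of% φ.map_mul, Iso.hom_inv_id, Category.comp_id]
  change φ.iso.inv ▷ A.X ≫ A.mul = _
  rw [h, MonoidalCategory.tensorHom_def]
  simp

lemma MIso.symm_sharp_snd {A B : MCat Q} (φ : MIso A B) :
    φ.symm.sharp.mor.snd = φ.iso.hom ▷ B.X ≫ B.mul ≫ φ.iso.inv := by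
  have h : A.mul = (φ.iso.hom ⊗ₘ φ.iso.hom) ≫ B.mul ≫ φ.iso.inv := by
    rw [← reassoc_of% φ.map_mul, Iso.hom_inv_id, Category.comp_id]
  change A.X ◁ φ.iso.inv ≫ A.mul = _
  rw [h, MonoidalCategory.tensorHom_def']
  simp

lemma MIso.comp_sharp_snd {Z A B : MCat Q} (f : Z ⟶ A) (φ : MIso A B) :
    (f ≫ φ.sharp).mor.snd = φ.iso.inv ▷ Z.X ≫ f.mor.snd ≫ φ.iso.hom := by
  refine (MHom.isComposite_comp f φ.sharp).snd_eq φ.sharp.dense ?_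
  have h := f.mor.snd_linear A.nondeg
  have h' : B.X ◁ φ.iso.hom ≫ B.mul = φ.iso.inv ▷ A.X ≫ A.mul ≫ φ.iso.hom := by
    rw [φ.map_mul, MonoidalCategory.tensorHom_def]
    simp
  dsimp only [MIso.sharp]
  have h2 := h =≫ φ.iso.hom
  simp only [Category.assoc] at h2
  rw [h', whisker_exchange_assoc, comp_whiskerRight, comp_whiskerRight]
  simp only [Category.assoc, hom_inv_whiskerRight_assoc, h2]
  simp

variable {A : MCat Q} {t₁ t₂ : A.X ⊗ A.X ⟶ A.X ⊗ A.X} {e : A.X ⟶ 𝟙_ C}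

omit [BraidedCategory C] hQ in
lemma mul_counit_of_action {S : Semigrp C} {e : S.X ⟶ 𝟙_ C}
    (h : S.mul ▷ 𝟙_ C ≫ (ρ_ S.X).hom ≫ e =
      (α_ S.X S.X (𝟙_ C)).hom ≫ S.X ◁ ((ρ_ S.X).hom ≫ e) ≫ (ρ_ S.X).hom ≫ e) :
    S.mul ≫ e = (e ⊗ₘ e) ≫ (λ_ _).hom := by
  have h := (ρ_ _).inv ≫= h
  rw [rightUnitor_naturality_assoc, Iso.inv_hom_id_assoc] at h
  rw [h, MonoidalCategory.tensorHom_def']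
  simp [unitors_equal]

lemma isComonoidFst_of_comonObj (c : ComonObj A) (he : c.counit.mor.fst = (ρ_ A.X).hom ≫ e)
    {d : A.X ⊗ (A.X ⊗ A.X) ⟶ A.X ⊗ A.X} (hd : c.comul.mor.fst = d) :
    IsComonoidFst A.toSemigrp d e := by
  have h1 : (c.comul ≫ MHom.tensor c.counit (𝟙 A)).mor.fst =
      A.X ◁ (λ_ A.X).hom ≫ A.mul ≫ (λ_ A.X).inv :=
    (congrArg (fun f : MHom A _ => f.mor.fst) c.counit_comul).trans
      (MIso.symm_sharp_fst (MCat.leftIso A))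
  have h2 : (c.comul ≫ MHom.tensor (𝟙 A) c.counit).mor.fst =
      A.X ◁ (ρ_ A.X).hom ≫ A.mul ≫ (ρ_ A.X).inv :=
    (congrArg (fun f : MHom A _ => f.mor.fst) c.comul_counit).trans
      (MIso.symm_sharp_fst (MCat.rightIso A))
  have h3 : (c.comul ≫ MHom.tensor (𝟙 A) c.comul).mor.fst =
      A.X ◁ (α_ A.X A.X A.X).inv ≫ (c.comul ≫ MHom.tensor c.comul (𝟙 A)).mor.fst ≫
        (α_ A.X A.X A.X).hom :=
    (congrArg (fun f : MHom A _ => f.mor.fst)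
      (c.comul_assoc.trans (Category.assoc _ _ _).symm)).trans
        (MIso.comp_sharp_fst _ (MCat.assocIso A A A))
  have g1 := (MHom.isComposite_comp c.comul (MHom.tensor c.counit (𝟙 A))).fst
  have g2 := (MHom.isComposite_comp c.comul (MHom.tensor (𝟙 A) c.counit)).fst
  have g3 := (MHom.isComposite_comp c.comul (MHom.tensor c.comul (𝟙 A))).fst
  have g4 := (MHom.isComposite_comp c.comul (MHom.tensor (𝟙 A) c.comul)).fst
  subst hd
  have g0 := c.counit.mult.fst
  rw [he] at g0
  refine ⟨c.comul.mult.fst, ?_, ?_, ?_, (c.comul ≫ MHom.tensor c.comul (𝟙 A)).mor.fst, ?_, ?_⟩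
  · exact mul_counit_of_action g0
  · rw [← h1, ← he]
    exact g1
  · rw [← h2, ← he]
    exact g2
  · exact g3
  · rw [← h3]
    exact g4

lemma isComonoidFst_mop_of_comonObj (c : ComonObj A)
    (he : c.counit.mor.fst = (ρ_ A.X).hom ≫ e) (he' : c.counit.mor.snd = (λ_ A.X).hom ≫ e)
    {d : (A.X ⊗ A.X) ⊗ A.X ⟶ A.X ⊗ A.X} (hd : c.comul.mor.snd = d) :
    IsComonoidFst A.toSemigrp.mop d.mop e.mop := by
  have h1 : (c.comul ≫ MHom.tensor c.counit (𝟙 A)).mor.snd =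
      (λ_ A.X).hom ▷ A.X ≫ A.mul ≫ (λ_ A.X).inv :=
    (congrArg (fun f : MHom A _ => f.mor.snd) c.counit_comul).trans
      (MIso.symm_sharp_snd (MCat.leftIso A))
  have h2 : (c.comul ≫ MHom.tensor (𝟙 A) c.counit).mor.snd =
      (ρ_ A.X).hom ▷ A.X ≫ A.mul ≫ (ρ_ A.X).inv :=
    (congrArg (fun f : MHom A _ => f.mor.snd) c.comul_counit).trans
      (MIso.symm_sharp_snd (MCat.rightIso A))
  have h3 : (c.comul ≫ MHom.tensor c.comul (𝟙 A)).mor.snd =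
      (α_ A.X A.X A.X).hom ▷ A.X ≫ (c.comul ≫ MHom.tensor (𝟙 A) c.comul).mor.snd ≫
        (α_ A.X A.X A.X).inv :=
    (congrArg (fun f : MHom A _ => f.mor.snd)
      ((Iso.eq_comp_inv (MCat.assocIso A A A).sharpIso).mpr
        (c.comul_assoc.trans (Category.assoc _ _ _).symm).symm)).trans
        (MIso.comp_sharp_snd _ (MCat.assocIso A A A).symm)
  have g1 := (MHom.isComposite_comp c.comul (MHom.tensor c.counit (𝟙 A))).snd
  have g2 := (MHom.isComposite_comp c.comul (MHom.tensor (𝟙 A) c.counit)).snd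
  have g3 := (MHom.isComposite_comp c.comul (MHom.tensor c.comul (𝟙 A))).snd
  have g4 := (MHom.isComposite_comp c.comul (MHom.tensor (𝟙 A) c.comul)).snd
  subst hd
  -- Reversal exchanges the two counit axioms and the two iterated comultiplications, so the witness
  -- now comes from `(1 ⊗ Δ) • Δ`.
  refine ⟨?_, ?_, ?_, ?_, (c.comul ≫ MHom.tensor (𝟙 A) c.comul).mor.snd.mop, ?_, ?_⟩ <;>
    apply Quiver.Hom.unmop_inj
  · change (A.X ⊗ A.X) ◁ A.mul ≫ c.comul.mor.snd =
      (α_ _ _ _).inv ≫ c.comul.mor.snd ▷ A.X ≫ c.comul.mor.snd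
    rw [Iso.eq_inv_comp]
    exact c.comul.mult.snd.symm
  · change A.mul ≫ e = (e ⊗ₘ e) ≫ (ρ_ _).hom
    have g0 := c.counit.mult.fst
    rw [he] at g0
    rw [← unitors_equal]
    exact mul_counit_of_action g0
  · change (A.X ⊗ 𝟙_ C) ◁ c.comul.mor.snd ≫
      (tensorμ (.mop A.X) (.mop A.X) (𝟙_ Cᴹᵒᵖ) (.mop A.X)).unmop ≫ (A.mul ⊗ₘ ((λ_ A.X).hom ≫ e)) =
        (α_ _ _ _).inv ≫ ((tensorμ (.mop A.X) (.mop A.X) (𝟙_ Cᴹᵒᵖ) (.mop A.X)).unmop ≫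
          (A.mul ⊗ₘ ((λ_ A.X).hom ≫ e))) ▷ A.X ≫ (ρ_ A.X).hom ▷ A.X ≫ A.mul ≫ (ρ_ A.X).inv
    rw [← h2, unmop_tensorμ, Iso.eq_inv_comp, ← he']
    exact g2.symm
  · change (𝟙_ C ⊗ A.X) ◁ c.comul.mor.snd ≫
      (tensorμ (.mop A.X) (.mop A.X) (.mop A.X) (𝟙_ Cᴹᵒᵖ)).unmop ≫ (((λ_ A.X).hom ≫ e) ⊗ₘ A.mul) =
        (α_ _ _ _).inv ≫ ((tensorμ (.mop A.X) (.mop A.X) (.mop A.X) (𝟙_ Cᴹᵒᵖ)).unmop ≫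
          (((λ_ A.X).hom ≫ e) ⊗ₘ A.mul)) ▷ A.X ≫ (λ_ A.X).hom ▷ A.X ≫ A.mul ≫ (λ_ A.X).inv
    rw [← h1, unmop_tensorμ, Iso.eq_inv_comp, ← he']
    exact g1.symm
  · change (A.X ⊗ (A.X ⊗ A.X)) ◁ c.comul.mor.snd ≫
      (tensorμ (.mop A.X) (.mop A.X) (.mop (A.X ⊗ A.X)) (.mop A.X)).unmop ≫
        (A.mul ⊗ₘ c.comul.mor.snd) = (α_ _ _ _).inv ≫
          ((tensorμ (.mop A.X) (.mop A.X) (.mop (A.X ⊗ A.X)) (.mop A.X)).unmop ≫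
            (A.mul ⊗ₘ c.comul.mor.snd)) ▷ A.X ≫ (c.comul ≫ MHom.tensor (𝟙 A) c.comul).mor.snd
    rw [unmop_tensorμ, Iso.eq_inv_comp]
    exact g4.symm
  · change ((A.X ⊗ A.X) ⊗ A.X) ◁ c.comul.mor.snd ≫
      (tensorμ (.mop A.X) (.mop A.X) (.mop A.X) (.mop (A.X ⊗ A.X))).unmop ≫
        (c.comul.mor.snd ⊗ₘ A.mul) = (α_ _ _ _).inv ≫
          ((tensorμ (.mop A.X) (.mop A.X) (.mop A.X) (.mop (A.X ⊗ A.X))).unmop ≫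
            (c.comul.mor.snd ⊗ₘ A.mul)) ▷ A.X ≫ (α_ _ _ _).hom ▷ A.X ≫
              (c.comul ≫ MHom.tensor (𝟙 A) c.comul).mor.snd ≫ (α_ _ _ _).inv
    rw [← h3, unmop_tensorμ, Iso.eq_inv_comp]
    exact g3.symm

/-- The comultiplication built from the fusion morphisms of a multiplier bimonoid. -/
def IsMultiplierBimonoid.comul (h : IsMultiplierBimonoid A.X t₁ t₂ e)
    (h₁ : t₁ ≫ e ▷ A.X ≫ (λ_ A.X).hom = A.mul) (h₂ : t₂ ≫ A.X ◁ e ≫ (ρ_ A.X).hom = A.mul)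
    (hd₁ : Q (comulFst A.mul t₁)) (hd₂ : Q (comulSnd A.mul t₂)) : MHom A (A.tensor A) where
  mor :=
    { fst := comulFst A.mul t₁
      snd := comulSnd A.mul t₂
      compat := (comul_compat_iff A.nondeg).mpr (compat_of_commute h₁ h₂ h.compat) }
  mult :=
    { fst := h.fusion₁.mul_comul A.nondeg h₁
      snd := by
        have h' := IsCounitalFusion.mul_comul (S := A.toSemigrp.mop)
          (isCounitalFusion_mop_iff.mpr h.fusion₂) A.nondeg.mop (Quiver.Hom.unmop_inj h₂)
        exact ((Iso.eq_inv_comp _).mp (congrArg Quiver.Hom.unmop h')).symm }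
  dense := ⟨hd₁, hd₂⟩

/-- The counit of a multiplier bimonoid. -/
def IsMultiplierBimonoid.counit (h : IsMultiplierBimonoid A.X t₁ t₂ e)
    (h₁ : t₁ ≫ e ▷ A.X ≫ (λ_ A.X).hom = A.mul) (he : Q e) : MHom A (MCat.unit Q) where
  mor :=
    { fst := (ρ_ A.X).hom ≫ e
      snd := (λ_ A.X).hom ≫ e
      compat := by
        simp
        rw [← unitors_inv_equal, Iso.inv_hom_id, Category.comp_id] }
  mult :=
    { fst := unit_action_assoc (h.fusion₁.mul_counit h₁)
      snd := unit_action_assoc_right (h.fusion₁.mul_counit h₁) }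
  dense := ⟨comp_mem _ _ (iso_mem _ inferInstance) he, comp_mem _ _ (iso_mem _ inferInstance) he⟩

/-- Equality in `ℳ` is tested on first components, so the comonoid axioms need only the fusion data
of `t₁`; `t₂` enters through the comultiplication being a morphism of `ℳ`. -/
lemma IsMultiplierBimonoid.exists_comonObj (h : IsMultiplierBimonoid A.X t₁ t₂ e)
    (h₁ : t₁ ≫ e ▷ A.X ≫ (λ_ A.X).hom = A.mul) (h₂ : t₂ ≫ A.X ◁ e ≫ (ρ_ A.X).hom = A.mul)
    (he : Q e) (hd₁ : Q (comulFst A.mul t₁)) (hd₂ : Q (comulSnd A.mul t₂)) :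
    ∃ c : ComonObj A, c.counit = h.counit h₁ he ∧ c.comul = h.comul h₁ h₂ hd₁ hd₂ := by
  have H := h.fusion₁.isComonoidFst h₁ A.nondeg (tensorEpi_of_mem A.mul_mem)
    (tensorEpi_of_mem hd₁) (tensorEpi_of_mem he)
  refine ⟨{
    counit := h.counit h₁ he
    comul := h.comul h₁ h₂ hd₁ hd₂
    counit_comul := MHom.fst_inj ((MHom.comp_fst_eq (h.comul h₁ h₂ hd₁ hd₂)
      (MHom.tensor (h.counit h₁ he) (𝟙 A)) H.counit_left).trans
        (MIso.symm_sharp_fst (MCat.leftIso A)).symm)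
    comul_counit := MHom.fst_inj ((MHom.comp_fst_eq (h.comul h₁ h₂ hd₁ hd₂)
      (MHom.tensor (𝟙 A) (h.counit h₁ he)) H.counit_right).trans
        (MIso.symm_sharp_fst (MCat.rightIso A)).symm)
    comul_assoc := ?_ }, rfl, rfl⟩
  obtain ⟨k, hk₁, hk₂⟩ := H.coassoc
  have e₁ := MHom.comp_fst_eq (h.comul h₁ h₂ hd₁ hd₂)
    (MHom.tensor (h.comul h₁ h₂ hd₁ hd₂) (𝟙 A)) hk₁
  have e₂ := MHom.comp_fst_eq (h.comul h₁ h₂ hd₁ hd₂)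
    (MHom.tensor (𝟙 A) (h.comul h₁ h₂ hd₁ hd₂)) hk₂
  refine Eq.trans (MHom.fst_inj (e₂.trans ?_)) (Category.assoc _ _ _)
  rw [← e₁]
  exact (MIso.comp_sharp_fst _ (MCat.assocIso A A A)).symm

/-- Density supplies the epimorphisms, and automatic linearity of the components of an `𝕄`-morphism
supplies linearity of `t₁` and `t₂`; the dictionary then applies on both sides. -/
lemma isMultiplierBimonoid_of_comonObj (c : ComonObj A)
    (he₁ : c.counit.mor.fst = (ρ_ A.X).hom ≫ e) (he₂ : c.counit.mor.snd = (λ_ A.X).hom ≫ e)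
    (hd₁ : c.comul.mor.fst = comulFst A.mul t₁) (hd₂ : c.comul.mor.snd = comulSnd A.mul t₂) :
    IsMultiplierBimonoid A.X t₁ t₂ e ∧ t₁ ≫ e ▷ A.X ≫ (λ_ A.X).hom = A.mul ∧
      t₂ ≫ A.X ◁ e ≫ (ρ_ A.X).hom = A.mul ∧
      Q e ∧ Q (comulFst A.mul t₁) ∧ Q (comulSnd A.mul t₂) := by
  have hQ₁ : Q (comulFst A.mul t₁) := hd₁ ▸ c.comul.dense.fst
  have hQ₂ : Q (comulSnd A.mul t₂) := hd₂ ▸ c.comul.dense.snd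
  have hQe : Q e := right_cancel (ρ_ A.X).hom e (iso_mem _ inferInstance)
    (he₁ ▸ c.counit.dense.fst)
  have hm := tensorEpi_of_mem A.mul_mem
  have hTe := tensorEpi_of_mem hQe
  have hT₁ := tensorEpi_of_mem hQ₁
  have H₁ := isComonoidFst_of_comonObj c he₁ hd₁
  have H₂ := isComonoidFst_mop_of_comonObj c he₁ he₂ hd₂
  have l₁ := MMor.fst_linear (A.tensor A).nondeg c.comul.mor
  rw [hd₁] at l₁
  have r₁ := (comulFst_linear_iff A.nondeg hm).mp l₁
  have l₂ := MMor.snd_linear (A.tensor A).nondeg c.comul.mor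
  rw [hd₂] at l₂
  -- Left linearity of `d₂` is right linearity of a first component for the reversed product.
  have r₂ := (comulFst_linear_iff (S := A.toSemigrp.mop) (t := t₂.mop) A.nondeg.mop hm.mop).mp (by
    apply Quiver.Hom.unmop_inj
    change (A.X ⊗ A.X) ◁ comulSnd A.mul t₂ ≫
      (tensorμ (.mop A.X) (.mop A.X) (.mop A.X) (.mop A.X)).unmop ≫ (A.mul ⊗ₘ A.mul) =
        (α_ _ _ _).inv ≫ ((tensorμ (.mop A.X) (.mop A.X) (.mop A.X) (.mop A.X)).unmop ≫
          (A.mul ⊗ₘ A.mul)) ▷ A.X ≫ comulSnd A.mul t₂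
    rw [unmop_tensorμ, Iso.eq_inv_comp]
    exact l₂.symm)
  have f₁ := H₁.isCounitalFusion A.nondeg hm hT₁ r₁
  have f₂ := IsComonoidFst.isCounitalFusion (S := A.toSemigrp.mop) (t := t₂.mop) H₂ A.nondeg.mop
    hm.mop (tensorEpi_of_mem hQ₂).mop r₂
  have c₁ := H₁.comp_counit hm hTe r₁
  have c₂ : t₂ ≫ A.X ◁ e ≫ (ρ_ A.X).hom = A.mul := congrArg Quiver.Hom.unmop
    (IsComonoidFst.comp_counit (S := A.toSemigrp.mop) (t := t₂.mop) H₂ hm.mop hTe.mop r₂)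
  have hc := c.comul.mor.compat
  rw [hd₁, hd₂] at hc
  exact ⟨⟨f₁, isCounitalFusion_mop_iff.mp f₂,
    f₁.commute A.nondeg hT₁ r₁ H₁.mul_comul ((comul_compat_iff A.nondeg).mp hc),
    c₁.trans c₂.symm⟩, c₁, c₂, hQe, hQ₁, hQ₂⟩

end Comonoids
end MultBimon

theorem mainTheorem1 {C : Type u} [Category.{v} C] [MonoidalCategory C] [BraidedCategory C]
    (Q : MorphismProperty C) [MultBimon.StandingAssumptions Q] (A : MultBimon.MCat Q)
    (t₁ t₂ : A.X ⊗ A.X ⟶ A.X ⊗ A.X) (e : A.X ⟶ 𝟙_ C) :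
    (∃ c : ComonObj A,
      c.counit.mor.fst = (ρ_ A.X).hom ≫ e ∧
      c.counit.mor.snd = (λ_ A.X).hom ≫ e ∧
      c.comul.mor.fst = MultBimon.comulFst A.mul t₁ ∧
      c.comul.mor.snd = MultBimon.comulSnd A.mul t₂) ↔
    (MultBimon.IsMultiplierBimonoid A.X t₁ t₂ e ∧
      t₁ ≫ e ▷ A.X ≫ (λ_ A.X).hom = A.mul ∧
      t₂ ≫ A.X ◁ e ≫ (ρ_ A.X).hom = A.mul ∧
      Q e ∧ Q (MultBimon.comulFst A.mul t₁) ∧ Q (MultBimon.comulSnd A.mul t₂)) := by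
  constructor
  · rintro ⟨c, he₁, he₂, hd₁, hd₂⟩
    exact MultBimon.isMultiplierBimonoid_of_comonObj c he₁ he₂ hd₁ hd₂
  · rintro ⟨h, h₁, h₂, he, hd₁, hd₂⟩
    obtain ⟨c, hε, hΔ⟩ := h.exists_comonObj h₁ h₂ he hd₁ hd₂
    exact ⟨c, by rw [hε, hΔ]; exact ⟨rfl, rfl, rfl, rfl⟩⟩
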